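/- **Setting.** Let $X$ be a connected simplicial complex of dimension $n\ge 2$ such that the link $X_u$ of every vertex $u$ is finite and connected. Let $\Gamma$ be a locally compact, unimodular topological group (for example, any discrete group) acting on $X$ by simplicial automorphisms, properly discontinuously (the stabilizer of every vertex is compact and open; for discrete $\Gamma$: finite) and cocompactly (there are finitely many orbits of simplices). For $k\ge 0$ let $\Sigma(k)$ be the set of ordered $k$-simplices of $X$, i.e. $(k+1)$-tuples of distinct vertices spanning a simplex, and let $\Sigma_u(k)$ be the corresponding set for the link $X_u$. Let $m:\Sigma(1)\cup\Sigma(2)\to(0,\infty)$ be a weight: $m$ is $\Gamma$-invariant, is invariant under permutations of the vertices of a simplex, and there is a constant $C(m)$ with $$\sum_{\sigma\in\Sigma(2),\ \tau\subset\sigma} m(\sigma)=3!\,C(m)\,m(\tau)\qquad\text{for all }\tau\in\Sigma(1),$$ where $\tau\subset\sigma$ means that all vertices of $\tau$ are vertices of $\sigma$. Let $f:[0,\infty)\to[0,\infty)$ be strictly increasing and strictly convex with $f(0)=0$, and such that $\sum_{k\ge1}f^{-1}(C\kappa^k)<\infty$ for all $0\le\kappa<1$ and $C\ge0$. Let $(Z,d)$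 be either (a) a nonempty, complete, uniquely geodesic metric space that is uniformly convex and non-positively curved in the sense of Busemann, or (b) a reflexive (real) Banach space, with the metric induced by the norm. In (a), write $\frac12x+\frac12y$ for the midpoint of the geodesic from $x$ to $y$. Uniformly convex means that there is $\theta:(0,\infty)\times(0,2]\to(0,1]$ with $\inf_{r>0}\theta(r,\varepsilon)>0$ for every $\varepsilon\in(0,2]$, such that $d(a,x)\le r$, $d(a,y)\le r$ and $d(x,y)\ge\varepsilon r$ imply $d(\frac12x+\frac12y,a)\le(1-\theta(r,\varepsilon))r$. Non-positively curved in the sense of Busemann means that $d(\frac12x+\frac12z,\frac12y+\frac12z)\le\frac12d(x,y)$ for all $x,y,z\in Z$. For a vertex $u$, a map $\phi:\Sigma_u(0)\to Z$ and $\xi\in Z$ put $$E_{u,\phi}(\xi)=\sum_{v\in\Sigma_u(0)}m((u,v))\,f(d(\xi,\phi(v))),$$ and let $M_u\phi$ be a point of $Z$ at which $E_{u,\phi}$ attains its minimum (only the minimal value is used below). Let $\lambda_u\in[0,\infty]$ be the supremum of all real $\lambda'$ such that $$\lambda'\,E_{u,\phi}(M_u\phi)\ \le\sum_{(v,w)\in\Sigma_u(1)}\frac{m((u,v,w))}{2}\,f(d(\phi(v),\phi(w)))\qquad\text{for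 all }\phi:\Sigma_u(0)\to Z,$$ and let $\lambda=\min_u\lambda_u$ over all vertices $u$ of $X$. **Theorem.** If $\lambda>\frac{C(m)}{2}$, then every action $\rho:\Gamma\to\mathrm{Isom}(Z)$ of $\Gamma$ on $Z$ by surjective isometries, continuous in the sense that $\gamma\mapsto\rho(\gamma)z$ is continuous for each $z\in Z$ (automatic if $\Gamma$ is discrete), has a fixed point: there is $z\in Z$ with $\rho(\gamma)z=z$ for all $\gamma\in\Gamma$. -/

import Mathlib

open scoped Pointwise

noncomputable section

namespace LinkFixedPoint

open Classical in
/-- The link of the vertex `u`: all nonempty `t` not containing `u` such that `{u} ∪ t` is a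
simplex. -/
def link {V : Type*} (X : AbstractSimplicialComplex V) (u : V) :
    PreAbstractSimplicialComplex V where
  faces := {t | t.Nonempty ∧ u ∉ t ∧ insert u t ∈ X.faces}
  isRelLowerSet_faces := by
    intro t ht
    refine ⟨ht.1, fun s hs hne => ⟨hne, fun h => ht.2.1 (hs h), ?_⟩⟩
    exact (X.isRelLowerSet_faces ht.2.2).2 (Finset.insert_subset_insert u hs)
      (Finset.insert_nonempty u s)

/-- The vertices of a complex (for the link of `u` this is the set `Σ_u(0)`). -/
abbrev Vertex {V : Type*} (K : PreAbstractSimplicialComplex V) : Type _ :=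
  {v : V // {v} ∈ K.faces}

open Classical in
/-- The 1-skeleton of a complex; its ordered adjacent pairs are the ordered 1-simplices. -/
def skeletonGraph {V : Type*} (K : PreAbstractSimplicialComplex V) : SimpleGraph (Vertex K) where
  Adj v w := v ≠ w ∧ ({v.1, w.1} : Finset V) ∈ K.faces
  symm := ⟨fun v w h => ⟨h.1.symm, by rw [Finset.pair_comm]; exact h.2⟩⟩
  loopless := ⟨fun v h => h.1 rfl⟩

/-- A simplicial complex is connected iff its 1-skeleton is connected as a graph. -/
def IsConnectedComplex {V : Type*} (K : PreAbstractSimplicialComplex V) : Prop :=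
  (skeletonGraph K).Connected

/-- The largest dimension of a simplex of `X` is exactly `n`. -/
def HasDimension {V : Type*} (X : AbstractSimplicialComplex V) (n : ℕ) : Prop :=
  (∃ s ∈ X.faces, s.card = n + 1) ∧ ∀ s ∈ X.faces, s.card ≤ n + 1

/-- `Σ(k)`: the ordered `k`-simplices, i.e. `(k+1)`-tuples of distinct vertices spanning a
simplex. -/
def orderedSimplices {V : Type*} (X : AbstractSimplicialComplex V) (k : ℕ) :
    Set (Fin (k + 1) → V) :=
  {σ | Function.Injective σ ∧ ∃ s ∈ X.faces, (s : Set V) = Set.range σ}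

section Action

variable {V : Type*} (Γ : Type*) [Group Γ] [MulAction Γ V]

open Classical in
/-- `Γ` acts by simplicial automorphisms. -/
def IsSimplicialAction (X : AbstractSimplicialComplex V) : Prop :=
  ∀ (γ : Γ), ∀ s ∈ X.faces, γ • s ∈ X.faces

open Classical in
/-- The action is cocompact: there are finitely many orbits of simplices. -/
def IsCocompactAction (X : AbstractSimplicialComplex V) : Prop :=
  ∃ F : Set (Finset V), F.Finite ∧ F ⊆ X.faces ∧ ∀ s ∈ X.faces, ∃ γ : Γ, ∃ t ∈ F, s = γ • t

/-- The action is properly discontinuous: stabilizers of vertices are compact and open (for a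
discrete group this says that they are finite). -/
def IsProperlyDiscontinuousAction (V : Type*) (Γ : Type*) [Group Γ] [TopologicalSpace Γ]
    [MulAction Γ V] : Prop :=
  ∀ v : V, IsCompact (MulAction.stabilizer Γ v : Set Γ) ∧
    IsOpen (MulAction.stabilizer Γ v : Set Γ)

/-- `m` is a weight with constant `C = C(m)`. Only the values of `m k` on ordered `k`-simplices,
`k = 1, 2`, are relevant. -/
structure IsWeight (X : AbstractSimplicialComplex V) (m : (k : ℕ) → (Fin (k + 1) → V) → ℝ)
    (C : ℝ) : Prop where
  pos : ∀ k, 1 ≤ k → k ≤ 2 → ∀ σ ∈ orderedSimplices X k, 0 < m k σ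
  equivariant : ∀ k, 1 ≤ k → k ≤ 2 → ∀ σ ∈ orderedSimplices X k, ∀ γ : Γ,
    m k (fun i => γ • σ i) = m k σ
  symmetric : ∀ k, 1 ≤ k → k ≤ 2 → ∀ σ ∈ orderedSimplices X k,
    ∀ π : Equiv.Perm (Fin (k + 1)), m k (σ ∘ π) = m k σ
  sum_eq : ∀ τ ∈ orderedSimplices X 1,
    ∑ᶠ σ ∈ {σ | σ ∈ orderedSimplices X 2 ∧ Set.range τ ⊆ Set.range σ}, m 2 σ =
      (Nat.factorial 3 : ℝ) * C * m 1 τ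

end Action

/-- An admissible energy function `f : [0,∞) → [0,∞)`: it is strictly increasing and strictly
convex with `f 0 = 0`, and `∑ₖ f⁻¹(C κᵏ)` converges whenever `0 ≤ κ < 1` and `0 ≤ C`. (These
properties make `f` a bijection of `[0,∞)`, so that the inverse below is a true inverse. Values of
`f` at negative numbers are irrelevant.) -/
structure IsEnergyFunction (f : ℝ → ℝ) : Prop where
  map_zero : f 0 = 0
  strictMono : StrictMonoOn f (Set.Ici 0)
  strictConvex : StrictConvexOn ℝ (Set.Ici 0) f
  summable : ∀ κ C : ℝ, 0 ≤ κ → κ < 1 → 0 ≤ C →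
    Summable fun k : ℕ => Function.invFunOn f (Set.Ici 0) (C * κ ^ (k + 1))

section Energy

variable {V Z : Type*} [MetricSpace Z] (X : AbstractSimplicialComplex V)
  (m : (k : ℕ) → (Fin (k + 1) → V) → ℝ) (f : ℝ → ℝ) (u : V)

/-- `E_{u,φ}(ξ) = ∑_{v ∈ Σ_u(0)} m((u,v)) f(d(ξ, φ(v)))`. -/
def vertexEnergy (φ : Vertex (link X u) → Z) (ξ : Z) : ℝ :=
  ∑ᶠ v : Vertex (link X u), m 1 ![u, v.1] * f (dist ξ (φ v))

/-- `∑_{η ∈ Σ_u(1)} (m_u(η) / 2) f(d_u φ(η))`, with `m_u((v,w)) = m((u,v,w))`. -/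
def linkEnergy (φ : Vertex (link X u) → Z) : ℝ :=
  ∑ᶠ (v : Vertex (link X u)) (w : Vertex (link X u)) (_ : (skeletonGraph (link X u)).Adj v w),
    m 2 ![u, v.1, w.1] / 2 * f (dist (φ v) (φ w))

/-- `ξ` is a point at which `E_{u,φ}` attains its minimum (`ξ = M_u φ`). -/
def IsEnergyMinimizer (φ : Vertex (link X u) → Z) (ξ : Z) : Prop :=
  ∀ ζ : Z, vertexEnergy X m f u φ ξ ≤ vertexEnergy X m f u φ ζ

/-- `λ_u`, the supremum, in the extended reals, of all real `l` with
`l * E_{u,φ}(M_u φ) ≤ ∑_{η ∈ Σ_u(1)} (m_u(η) / 2) f(d_u φ(η))` for all `φ : Σ_u(0) → Z`.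
All minimizers of `E_{u,φ}` have the same energy, so the choice of `M_u φ` is irrelevant. -/
def linkConstant (Z : Type*) [MetricSpace Z] (X : AbstractSimplicialComplex V)
    (m : (k : ℕ) → (Fin (k + 1) → V) → ℝ) (f : ℝ → ℝ) (u : V) : EReal :=
  sSup ((fun l : ℝ => (l : EReal)) '' {l : ℝ | ∀ (φ : Vertex (link X u) → Z) (ξ : Z),
    IsEnergyMinimizer X m f u φ ξ → l * vertexEnergy X m f u φ ξ ≤ linkEnergy X m f u φ})

/-- `λ`, the minimum of the `λ_u` over the vertices `u`. (It is a minimum when there are finitely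
many orbits of vertices, as `λ_u` depends only on the orbit of `u`.) -/
def minLinkConstant (Z : Type*) [MetricSpace Z] (X : AbstractSimplicialComplex V)
    (m : (k : ℕ) → (Fin (k + 1) → V) → ℝ) (f : ℝ → ℝ) : EReal :=
  ⨅ u : V, linkConstant Z X m f u

end Energy

section Metric

variable {Z : Type*} [MetricSpace Z]

/-- `c`, restricted to `[0, d(x,y)]`, is a geodesic from `x` to `y`. -/
def IsGeodesic (c : ℝ → Z) (x y : Z) : Prop :=
  c 0 = x ∧ c (dist x y) = y ∧
    ∀ s ∈ Set.Icc 0 (dist x y), ∀ t ∈ Set.Icc 0 (dist x y), dist (c s) (c t) = |s - t|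

/-- Any two points are joined by exactly one geodesic. -/
def IsUniquelyGeodesic (Z : Type*) [MetricSpace Z] : Prop :=
  ∀ x y : Z, (∃ c : ℝ → Z, IsGeodesic c x y) ∧
    ∀ c c' : ℝ → Z, IsGeodesic c x y → IsGeodesic c' x y →
      Set.EqOn c c' (Set.Icc 0 (dist x y))

/-- `p` is the midpoint `½x + ½y` of a geodesic from `x` to `y`. -/
def IsGeodesicMidpoint (x y p : Z) : Prop :=
  ∃ c : ℝ → Z, IsGeodesic c x y ∧ c (dist x y / 2) = p

/-- Uniform convexity of a (uniquely geodesic) metric space, with modulus `θ(r, ε)` bounded away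
from zero in `r` for each `ε`. -/
def IsUniformlyConvex (Z : Type*) [MetricSpace Z] : Prop :=
  ∃ θ : ℝ → ℝ → ℝ,
    (∀ r ε : ℝ, 0 < r → 0 < ε → ε ≤ 2 → 0 < θ r ε ∧ θ r ε ≤ 1) ∧
    (∀ r ε : ℝ, 0 < r → 0 < ε → ε ≤ 2 → ∀ a x y p : Z, IsGeodesicMidpoint x y p →
      dist a x ≤ r → dist a y ≤ r → ε * r ≤ dist x y → dist p a ≤ (1 - θ r ε) * r) ∧
    ∀ ε : ℝ, 0 < ε → ε ≤ 2 → 0 < ⨅ r : Set.Ioi (0 : ℝ), θ r ε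

/-- Non-positive curvature in the sense of Busemann, for a (uniquely geodesic) metric space. -/
def IsBusemannNPC (Z : Type*) [MetricSpace Z] : Prop :=
  ∀ x y z p q : Z, IsGeodesicMidpoint x z p → IsGeodesicMidpoint y z q →
    dist p q ≤ dist x y / 2

end Metric

/-- A normed space is reflexive: the canonical map to the bidual is surjective. -/
def IsReflexive (Z : Type*) [NormedAddCommGroup Z] [NormedSpace ℝ Z] : Prop :=
  Function.Surjective (NormedSpace.inclusionInDoubleDual ℝ Z)

/-- Every action of `Γ` on `Z` by surjective isometries with continuous orbit maps has a global
fixed point. (If `Γ` is discrete, continuity is automatic.) -/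
def EveryIsometricActionHasFixedPoint (Γ : Type*) [Group Γ] [TopologicalSpace Γ]
    (Z : Type*) [MetricSpace Z] : Prop :=
  ∀ ρ : Γ →* (Z ≃ᵢ Z), (∀ z : Z, Continuous fun γ : Γ => ρ γ z) → ∃ z : Z, ∀ γ : Γ, ρ γ z = z

end LinkFixedPoint

end

open LinkFixedPoint

/-! The idea is to improve a `Γ`-equivariant map `φ : V → Z` repeatedly until it becomes constant;
its constant value is then a fixed point. Let `χ u` be an equivariant choice of minimizers of the
local energies of `φ`, and replace `φ u` by the midpoint of `φ u` and `χ u`. Write `E(φ, χ)` for the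
sum of `a u v * f (dist (φ u) (χ v))` over vertices `u` modulo `Γ` and all `v`, each orbit being
weighted by the inverse Haar measure of a stabilizer.

Two estimates make `E(φ, φ)` contract. By symmetry of midpoints, the new distance along an edge is
at most the average of the crossed distances `dist (φ u) (χ v)` and `dist (χ u) (φ v)`. Convexity of
`f` and symmetry of `E` then bound the new energy by `E(χ, φ)` (`totalEnergy_mid_le`). On the other
hand, the Poincaré inequality with constant `l > C / 2` in every link, summed over vertices modulo
`Γ`, gives `E(χ, φ) ≤ (C / 2 / l) E(φ, φ)` (`totalEnergy_minimizer_le`), because each edge is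
counted with total weight `C` by its triangles (`orbitSum_triangles`). Moving sums from one vertex
of a simplex to another is the mass transport principle (`mass_transport`), which depends on
unimodularity.

Energies thus decay like `κ ^ k`. The energy also controls the displacement of a vertex in one step
(`map_dist_mid_le`), so the summability of `f⁻¹(K κ ^ k)` makes the maps converge at a vertex;
vanishing edge energies and connectedness of `X` force the same limit at all vertices
(`exists_fixedPoint`).

The target enters only through `IsConvexMidpoint`, which replaces compactness by nested
intersections, and `HasCompactFixedPoints`, which makes choices invariant under compact stabilizers.
These follow from uniform convexity and circumcentres in the geodesic case, and from weak-*
compactness and Haar averages in the Banach case. -/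

namespace LinkFixedPoint

/-! ### Mass transport for actions of unimodular groups -/

section MassTransport

open MeasureTheory

variable {V Γ : Type*} [Group Γ] [TopologicalSpace Γ] [MulAction Γ V]

lemma isOpen_setOf_smul_eq [IsTopologicalGroup Γ]
    (hproper : IsProperlyDiscontinuousAction V Γ) (s v : V) :
    IsOpen {γ : Γ | γ • s = v} := by
  by_cases h : v ∈ MulAction.orbit Γ s
  · obtain ⟨g, rfl⟩ := h
    convert (hproper s).2.preimage (continuous_const_mul g⁻¹) using 1
    ext γ
    simp [mul_smul, inv_smul_eq_iff]
  · convert isOpen_empty (X := Γ)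
    ext γ
    simp only [Set.mem_ofPred_eq, Set.mem_empty_iff_false, iff_false]
    rintro rfl
    exact h ⟨γ, rfl⟩

-- `V` has no σ-algebra and may be uncountable. Finite support of `G` reduces the integral to a
-- finite sum of indicators of fibres.
open Classical in
lemma lintegral_comp_eq_tsum {Ω V : Type*} [MeasurableSpace Ω] (μ : Measure Ω) (p : Ω → V)
    (hp : ∀ v, MeasurableSet {γ | p γ = v}) (G : V → ENNReal) (hG : G.support.Finite) :
    ∫⁻ γ, G (p γ) ∂μ = ∑' v, G v * μ {γ | p γ = v} := by
  have h1 : ∀ x, G x = ∑ v ∈ hG.toFinset, G v * Set.indicator {y | y = v} 1 x := by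
    intro x
    by_cases hx : G x = 0
    · rw [hx]
      symm
      refine Finset.sum_eq_zero fun v hv => ?_
      have : x ≠ v := by
        rintro rfl
        simp [hx] at hv
      simp [this]
    · rw [Finset.sum_eq_single x]
      · simp
      · intro v _ hv
        simp [hv.symm]
      · intro h
        simp at h
        simp [h]
  rw [tsum_eq_sum (s := hG.toFinset)]
  · calc ∫⁻ γ, G (p γ) ∂μ
        = ∫⁻ γ, ∑ v ∈ hG.toFinset, G v * Set.indicator {γ | p γ = v} 1 γ ∂μ := by
          refine lintegral_congr fun γ => ?_
          rw [h1 (p γ)]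
          rfl
      _ = ∑ v ∈ hG.toFinset, G v * μ {γ | p γ = v} := by
          rw [lintegral_finsetSum]
          · refine Finset.sum_congr rfl fun v _ => ?_
            rw [lintegral_const_mul _ (measurable_one.indicator (hp v)),
              lintegral_indicator_one (hp v)]
          · intro v _
            exact (measurable_one.indicator (hp v)).const_mul _
  · intro v hv
    simp at hv
    simp [hv]

lemma measure_stabilizer_ne_zero [MeasurableSpace Γ] (μ : Measure Γ) [μ.IsHaarMeasure]
    (hproper : IsProperlyDiscontinuousAction V Γ) (s : V) :
    μ (MulAction.stabilizer Γ s : Set Γ) ≠ 0 :=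
  ((hproper s).2.measure_pos μ ⟨1, one_mem _⟩).ne'

lemma measure_stabilizer_ne_top [MeasurableSpace Γ] (μ : Measure Γ) [μ.IsHaarMeasure]
    (hproper : IsProperlyDiscontinuousAction V Γ) (s : V) :
    μ (MulAction.stabilizer Γ s : Set Γ) ≠ ⊤ :=
  (hproper s).1.measure_lt_top.ne

/-- `R` contains exactly one point of each orbit. -/
def IsOrbitTransversal (Γ : Type*) {V : Type*} [Group Γ] [MulAction Γ V] (R : Finset V) : Prop :=
  ∀ v : V, ∃! r, r ∈ R ∧ v ∈ MulAction.orbit Γ r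

section Transversal

variable {V Γ : Type*} [Group Γ] [MulAction Γ V]

/-- A finite set meeting all orbits contains a transversal. -/
lemma exists_isOrbitTransversal (S : Finset V) (hS : ∀ v : V, ∃ r ∈ S, v ∈ MulAction.orbit Γ r) :
    ∃ R : Finset V, IsOrbitTransversal Γ R := by
  classical
  let q : V → MulAction.orbitRel.Quotient Γ V := Quotient.mk''
  refine ⟨(S.image q).image Quotient.out, fun v => ?_⟩
  have hq : ∀ x : V, x ∈ MulAction.orbit Γ (q x).out := fun x => by
    rw [MulAction.mem_orbit_symm]
    exact Quotient.exact (s := MulAction.orbitRel Γ V) (Quotient.out_eq (q x))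
  obtain ⟨r, hr, hv⟩ := hS v
  have hqr : q v = q r := Quotient.sound (s := MulAction.orbitRel Γ V) hv
  refine ⟨(q v).out, ⟨?_, hq v⟩, ?_⟩
  · exact Finset.mem_image_of_mem _ (hqr ▸ Finset.mem_image_of_mem _ hr)
  · rintro y ⟨hy, hvy⟩
    obtain ⟨z, -, rfl⟩ := Finset.mem_image.1 hy
    have : q v = q z.out := Quotient.sound (s := MulAction.orbitRel Γ V) hvy
    rw [this]
    congr 1
    exact (Quotient.out_eq z).symm

end Transversal

/-- The set is empty or a left coset of the stabilizer, so left invariance suffices. -/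
lemma measure_smul_eq [IsTopologicalGroup Γ] [MeasurableSpace Γ] [BorelSpace Γ]
    (μ : Measure Γ) [μ.IsHaarMeasure] (s v : V)
    [Decidable (v ∈ MulAction.orbit Γ s)] :
    μ {γ : Γ | γ • s = v} =
      if v ∈ MulAction.orbit Γ s then μ (MulAction.stabilizer Γ s : Set Γ) else 0 := by
  split_ifs with h
  · obtain ⟨g, hg⟩ := h
    rw [← measure_preimage_mul μ g⁻¹ (MulAction.stabilizer Γ s : Set Γ), ← hg]
    congr 1
    ext γ
    simp [mul_smul, inv_smul_eq_iff]
  · convert measure_empty (μ := μ)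
    ext γ
    simp only [Set.mem_ofPred_eq, Set.mem_empty_iff_false, iff_false]
    rintro rfl
    exact h ⟨γ, rfl⟩

variable [IsTopologicalGroup Γ] [LocallyCompactSpace Γ] [MeasurableSpace Γ] [BorelSpace Γ]

/-- In a unimodular group, right translates of a compact open set have the same Haar measure. -/
lemma measure_preimage_mul_right_of_unimodular
    (hunimod : ∀ γ : Γ, Measure.modularCharacter γ = 1) (μ : Measure Γ) [μ.IsHaarMeasure]
    {K : Set Γ} (hK : IsCompact K) (hKo : IsOpen K) (g : Γ) :
    μ ((· * g) ⁻¹' K) = μ K := by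
  have h1 : Measure.haarScalarFactor (μ.map (· * g)) μ = 1 := by
    rw [← Measure.modularCharacterFun_eq_haarScalarFactor]
    exact hunimod g
  have h2 := Measure.measure_isMulInvariant_eq_smul_of_isCompact_closure
    (μ.map (· * g)) μ hK.closure
  rw [h1, one_smul, Measure.map_apply (measurable_mul_const g) hKo.measurableSet] at h2
  exact h2

/-- Inverting `γ` turns the left coset into a right coset `Stab(s) g⁻¹`; this is where unimodularity
is needed. -/
lemma measure_inv_smul_eq (hunimod : ∀ γ : Γ, Measure.modularCharacter γ = 1)
    (μ : Measure Γ) [μ.IsHaarMeasure] (hproper : IsProperlyDiscontinuousAction V Γ) (s v : V)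
    [Decidable (v ∈ MulAction.orbit Γ s)] :
    μ {γ : Γ | γ⁻¹ • s = v} =
      if v ∈ MulAction.orbit Γ s then μ (MulAction.stabilizer Γ s : Set Γ) else 0 := by
  split_ifs with h
  · obtain ⟨g, hg⟩ := h
    rw [← measure_preimage_mul_right_of_unimodular hunimod μ (hproper s).1 (hproper s).2 g, ← hg]
    congr 1
    ext γ
    simp [mul_smul, inv_smul_eq_iff, eq_comm (a := s)]
  · convert measure_empty (μ := μ)
    ext γ
    simp only [Set.mem_ofPred_eq, Set.mem_empty_iff_false, iff_false]
    rintro rfl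
    exact h ⟨γ⁻¹, rfl⟩

open Classical in
/-- The mass transport principle for a pair of orbits. -/
lemma mass_transport_pair (hunimod : ∀ γ : Γ, Measure.modularCharacter γ = 1)
    (μ : Measure Γ) [μ.IsHaarMeasure] (hproper : IsProperlyDiscontinuousAction V Γ)
    (F : V → V → ENNReal) (hF : ∀ (γ : Γ) u v, F (γ • u) (γ • v) = F u v)
    (hrow : ∀ u, (F u).support.Finite) (hcol : ∀ v, (fun u => F u v).support.Finite) (r s : V) :
    (μ (MulAction.stabilizer Γ r : Set Γ))⁻¹ *
        ∑' v, (if v ∈ MulAction.orbit Γ s then F r v else 0) =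
      (μ (MulAction.stabilizer Γ s : Set Γ))⁻¹ *
        ∑' v, (if v ∈ MulAction.orbit Γ r then F v s else 0) := by
  -- The whole principle is this one integral evaluated in two ways: the left side distributes over
  -- the orbit of `s`, the right side over the orbit of `r`.
  have h1 : ∫⁻ γ : Γ, F r (γ • s) ∂μ = ∫⁻ γ : Γ, F (γ⁻¹ • r) s ∂μ := by
    refine lintegral_congr fun γ => ?_
    rw [← hF γ (γ⁻¹ • r) s, smul_inv_smul]
  rw [lintegral_comp_eq_tsum μ (fun γ => γ • s)
      (fun v => (isOpen_setOf_smul_eq hproper s v).measurableSet) (F r) (hrow r),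
    lintegral_comp_eq_tsum μ (fun γ => γ⁻¹ • r) (fun v => by
      have := (isOpen_setOf_smul_eq hproper r v).preimage (continuous_inv (G := Γ))
      exact this.measurableSet) (fun v => F v s) (hcol s)] at h1
  simp only [measure_smul_eq, measure_inv_smul_eq hunimod μ hproper] at h1
  have h2 : ∀ (x : V) (c : ENNReal) (G : V → ENNReal),
      ∑' v, G v * (if v ∈ MulAction.orbit Γ x then c else 0) =
        c * ∑' v, (if v ∈ MulAction.orbit Γ x then G v else 0) := by
    intro x c G
    rw [← ENNReal.tsum_mul_left]
    refine tsum_congr fun v => ?_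
    split_ifs <;> simp [mul_comm]
  rw [h2, h2] at h1
  have hr0 := measure_stabilizer_ne_zero μ hproper r
  have hrt := measure_stabilizer_ne_top μ hproper r
  have hs0 := measure_stabilizer_ne_zero μ hproper s
  have hst := measure_stabilizer_ne_top μ hproper s
  rw [← ENNReal.mul_right_inj hs0 hst, ← mul_assoc, mul_comm _ (_)⁻¹, mul_assoc, h1, ← mul_assoc,
    ENNReal.inv_mul_cancel hr0 hrt, one_mul, ← mul_assoc, ENNReal.mul_inv_cancel hs0 hst, one_mul]

/-- The sum over a transversal `R`, weighted with the inverse measures of the stabilizers. -/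
noncomputable def orbitSum (μ : Measure Γ) (R : Finset V) (F : V → ENNReal) : ENNReal :=
  ∑ r ∈ R, (μ (MulAction.stabilizer Γ r : Set Γ))⁻¹ * F r

/-- The mass transport principle. -/
lemma mass_transport (hunimod : ∀ γ : Γ, Measure.modularCharacter γ = 1)
    (μ : Measure Γ) [μ.IsHaarMeasure] (hproper : IsProperlyDiscontinuousAction V Γ)
    {R : Finset V} (hR : IsOrbitTransversal Γ R)
    (F : V → V → ENNReal) (hF : ∀ (γ : Γ) u v, F (γ • u) (γ • v) = F u v)
    (hrow : ∀ u, (F u).support.Finite) (hcol : ∀ v, (fun u => F u v).support.Finite) :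
    orbitSum μ R (fun u => ∑' v, F u v) = orbitSum μ R (fun u => ∑' v, F v u) := by
  classical
  have split : ∀ G : V → ENNReal,
      ∑' v, G v = ∑ s ∈ R, ∑' v, (if v ∈ MulAction.orbit Γ s then G v else 0) := by
    intro G
    rw [← Summable.tsum_finsetSum fun _ _ => ENNReal.summable]
    refine tsum_congr fun v => ?_
    obtain ⟨r, ⟨hr, hv⟩, huniq⟩ := hR v
    rw [Finset.sum_eq_single r, if_pos hv]
    · intro s hs hsr
      exact if_neg fun h => hsr (huniq s ⟨hs, h⟩)
    · exact fun h => absurd hr h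
  have expand : ∀ G : V → V → ENNReal, orbitSum μ R (fun u => ∑' v, G u v) =
      ∑ r ∈ R, ∑ s ∈ R, (μ (MulAction.stabilizer Γ r : Set Γ))⁻¹ *
        ∑' v, (if v ∈ MulAction.orbit Γ s then G r v else 0) := fun G =>
    Finset.sum_congr rfl fun r _ => by
      rw [← Finset.mul_sum, ← split]
  rw [expand F, expand fun u v => F v u, Finset.sum_comm]
  refine Finset.sum_congr rfl fun s _ => Finset.sum_congr rfl fun r _ => ?_
  exact mass_transport_pair hunimod μ hproper F hF hrow hcol r s

end MassTransport

/-! ### Abstract convex midpoints -/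

section Midpoints

/-- `A` is closed under taking midpoints. -/
def MidClosed {Z : Type*} (mid : Z → Z → Z) (A : Set Z) : Prop :=
  ∀ x ∈ A, ∀ y ∈ A, mid x y ∈ A

/-- A choice of midpoints which is convex, natural and for which the convex sets have the
nested intersection property. -/
structure IsConvexMidpoint {Z : Type*} [MetricSpace Z] (mid : Z → Z → Z) : Prop where
  symm : ∀ x y, mid x y = mid y x
  dist_mid_mid_le : ∀ x y x' y', dist (mid x y) (mid x' y') ≤ (dist x x' + dist y y') / 2
  dist_left_le : ∀ x y, dist x (mid x y) ≤ dist x y / 2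
  map_mid : ∀ (g : Z ≃ᵢ Z) x y, g (mid x y) = mid (g x) (g y)
  nested : ∀ A : ℕ → Set Z, Antitone A → (∀ n, (A n).Nonempty) → (∀ n, IsClosed (A n)) →
    (∀ n, Bornology.IsBounded (A n)) → (∀ n, MidClosed mid (A n)) → (⋂ n, A n).Nonempty

variable {Z : Type*} [MetricSpace Z]

lemma IsConvexMidpoint.mid_self {mid : Z → Z → Z} (h : IsConvexMidpoint mid) (x : Z) :
    mid x x = x := by
  have := h.dist_left_le x x
  rw [dist_self, zero_div] at this
  exact (dist_le_zero.1 this).symm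

lemma IsConvexMidpoint.dist_mid_le {mid : Z → Z → Z} (h : IsConvexMidpoint mid) (x y a : Z) :
    dist (mid x y) a ≤ (dist x a + dist y a) / 2 := by
  simpa [h.mid_self] using h.dist_mid_mid_le x y a a

lemma IsConvexMidpoint.midClosed_closedBall {mid : Z → Z → Z} (h : IsConvexMidpoint mid)
    (a : Z) (r : ℝ) : MidClosed mid (Metric.closedBall a r) := fun x hx y hy => by
  have := h.dist_mid_le x y a
  simp only [Metric.mem_closedBall] at *
  linarith

/-- Every closed bounded convex nonempty set invariant under a compact subgroup contains a point
fixed by this subgroup. -/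
def HasCompactFixedPoints {Γ Z : Type*} [Group Γ] [TopologicalSpace Γ] [MetricSpace Z]
    (mid : Z → Z → Z) (ρ : Γ →* (Z ≃ᵢ Z)) : Prop :=
  ∀ K : Subgroup Γ, IsCompact (K : Set Γ) → ∀ A : Set Z, A.Nonempty → IsClosed A →
    Bornology.IsBounded A → MidClosed mid A → (∀ k ∈ K, ∀ x ∈ A, ρ k x ∈ A) →
    ∃ x ∈ A, ∀ k ∈ K, ρ k x = x

end Midpoints

/-! ### Uniformly convex Busemann spaces -/

section Geodesic

variable {Z : Type*} [MetricSpace Z]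

/-- The midpoint of two points of a uniquely geodesic space. -/
noncomputable def geodesicMid (h : IsUniquelyGeodesic Z) (x y : Z) : Z :=
  (h x y).1.choose (dist x y / 2)

lemma half_dist_mem_Icc (x y : Z) : dist x y / 2 ∈ Set.Icc 0 (dist x y) := by
  have := dist_nonneg (x := x) (y := y)
  constructor <;> linarith

lemma isGeodesicMidpoint_geodesicMid (h : IsUniquelyGeodesic Z) (x y : Z) :
    IsGeodesicMidpoint x y (geodesicMid h x y) :=
  ⟨_, (h x y).1.choose_spec, rfl⟩

lemma IsGeodesicMidpoint.eq_geodesicMid (h : IsUniquelyGeodesic Z) {x y p : Z}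
    (hp : IsGeodesicMidpoint x y p) : p = geodesicMid h x y := by
  obtain ⟨c, hc, rfl⟩ := hp
  exact (h x y).2 c _ hc (h x y).1.choose_spec (half_dist_mem_Icc x y)

lemma IsGeodesicMidpoint.symm {x y p : Z} (hp : IsGeodesicMidpoint x y p) :
    IsGeodesicMidpoint y x p := by
  obtain ⟨c, ⟨h0, h1, hd⟩, rfl⟩ := hp
  refine ⟨fun t => c (dist x y - t), ⟨by simpa using h1, by simpa [dist_comm y x] using h0, ?_⟩, ?_⟩
  · rw [dist_comm y x]
    intro s hs t ht
    rw [hd _ ⟨by linarith [hs.2], by linarith [hs.1]⟩ _ ⟨by linarith [ht.2], by linarith [ht.1]⟩,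
      abs_sub_comm]
    congr 1
    ring
  · rw [dist_comm y x]
    ring_nf

lemma IsGeodesicMidpoint.map {x y p : Z} (hp : IsGeodesicMidpoint x y p) (g : Z ≃ᵢ Z) :
    IsGeodesicMidpoint (g x) (g y) (g p) := by
  obtain ⟨c, ⟨h0, h1, hd⟩, rfl⟩ := hp
  exact ⟨fun t => g (c t), ⟨by simp [h0], by simp [g.dist_eq, h1],
    by simpa [g.dist_eq] using hd⟩, by simp [g.dist_eq]⟩

lemma IsGeodesicMidpoint.dist_left {x y p : Z} (hp : IsGeodesicMidpoint x y p) :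
    dist x p = dist x y / 2 := by
  obtain ⟨c, ⟨h0, h1, hd⟩, rfl⟩ := hp
  have := hd 0 ⟨le_rfl, dist_nonneg⟩ _ (half_dist_mem_Icc x y)
  rw [h0] at this
  rw [this, zero_sub, abs_neg, abs_of_nonneg (half_dist_mem_Icc x y).1]

/-- The uniform modulus of convexity. -/
lemma IsUniformlyConvex.exists_modulus (h : IsUniformlyConvex Z) {ε : ℝ} (h0 : 0 < ε)
    (h2 : ε ≤ 2) : ∃ δ : ℝ, 0 < δ ∧ ∀ r : ℝ, 0 < r → ∀ a x y p : Z, IsGeodesicMidpoint x y p →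
      dist a x ≤ r → dist a y ≤ r → ε * r ≤ dist x y → dist p a ≤ (1 - δ) * r := by
  obtain ⟨θ, h01, hmid, hinf⟩ := h
  refine ⟨_, hinf ε h0 h2, fun r hr a x y p hp hx hy hxy => ?_⟩
  refine (hmid r ε hr h0 h2 a x y p hp hx hy hxy).trans ?_
  gcongr
  exact ciInf_le ⟨0, by rintro _ ⟨s, rfl⟩; exact (h01 s ε s.2 h0 h2).1.le⟩ (⟨r, hr⟩ : Set.Ioi (0 : ℝ))

/-- Almost nearest points of `A n` to a base point `a` form a Cauchy sequence: the distances from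
`a` to `A n` increase to a limit `S`, and if two such points in `A N` stayed far apart, their
midpoint would be closer to `a` than `A N` is. -/
lemma uniformlyConvex_nested [CompleteSpace Z] (hg : IsUniquelyGeodesic Z)
    (hu : IsUniformlyConvex Z) (A : ℕ → Set Z) (hanti : Antitone A)
    (hne : ∀ n, (A n).Nonempty) (hcl : ∀ n, IsClosed (A n))
    (hbd : ∀ n, Bornology.IsBounded (A n)) (hmid : ∀ n, MidClosed (geodesicMid hg) (A n)) :
    (⋂ n, A n).Nonempty := by
  obtain ⟨a, -⟩ := hne 0
  set s : ℕ → ℝ := fun n => Metric.infDist a (A n) with hs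
  have hmono : Monotone s := fun n k hnk => Metric.infDist_le_infDist_of_subset (hanti hnk) (hne k)
  obtain ⟨B, hB⟩ := (hbd 0).subset_closedBall a
  have hbdd : BddAbove (Set.range s) := by
    refine ⟨B, ?_⟩
    rintro _ ⟨n, rfl⟩
    obtain ⟨x, hx⟩ := hne n
    refine (Metric.infDist_le_dist_of_mem hx).trans ?_
    rw [dist_comm]
    exact hB (hanti (Nat.zero_le n) hx)
  have hlim := tendsto_atTop_ciSup hmono hbdd
  set S := ⨆ n, s n
  have hsS : ∀ n, s n ≤ S := fun n => le_ciSup hbdd n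
  have hS0 : 0 ≤ S := Metric.infDist_nonneg.trans (hsS 0)
  have hx : ∀ n : ℕ, ∃ x ∈ A n, dist a x < S + 1 / ((n : ℝ) + 1) := fun n => by
    refine (Metric.infDist_lt_iff (hne n)).1 ((hsS n).trans_lt ?_)
    have : (0 : ℝ) < 1 / ((n : ℝ) + 1) := by positivity
    linarith
  choose x hxA hxd using hx
  have hlim1 : Filter.Tendsto (fun n : ℕ => 1 / ((n : ℝ) + 1)) Filter.atTop (nhds 0) :=
    tendsto_one_div_add_atTop_nhds_zero_nat
  have hle : ∀ N n : ℕ, N ≤ n → dist a (x n) ≤ S + 1 / ((N : ℝ) + 1) := fun N n hn => by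
    refine (hxd n).le.trans ?_
    gcongr
  have hcauchy : CauchySeq x := by
    rw [Metric.cauchySeq_iff]
    intro ε hε
    -- For `S = 0` there is no strict inequality `(1 - δ) * S < S` to exploit, but the points then
    -- simply converge to `a`.
    rcases hS0.eq_or_lt with h0 | hpos
    · obtain ⟨N, hN⟩ := (hlim1.eventually_lt_const (half_pos hε)).exists
      refine ⟨N, fun n hn k hk => ?_⟩
      have h1 := hle N n hn
      have h2 := hle N k hk
      have h3 := dist_triangle_left (x n) (x k) a
      rw [← h0] at h1 h2
      linarith
    -- The radii used below are at most `S + 1`, so separation `ε` is at least this relative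
    -- separation times the radius.
    · have hε' : 0 < min (ε / (S + 1)) 2 := lt_min (by positivity) two_pos
      obtain ⟨δ, hδ, hconv⟩ := hu.exists_modulus hε' (min_le_right _ _)
      have hlt : (1 - δ) * (S + 0) < S := by nlinarith
      obtain ⟨N, hN⟩ := (((hlim1.const_add S).const_mul (1 - δ)).eventually_lt hlim hlt).exists
      refine ⟨N, fun n hn k hk => ?_⟩
      by_contra! hcon
      have hr1 : 1 / ((N : ℝ) + 1) ≤ 1 := by
        rw [div_le_one (by positivity)]
        linarith [Nat.cast_nonneg (α := ℝ) N]
      have hr0 : 0 < 1 / ((N : ℝ) + 1) := by positivity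
      have key := hconv (S + 1 / ((N : ℝ) + 1)) (by linarith) a (x n) (x k) _
        (isGeodesicMidpoint_geodesicMid hg _ _) (hle N n hn) (hle N k hk) (by
          refine le_trans ?_ hcon
          calc _ ≤ ε / (S + 1) * (S + 1) := by
                gcongr
                exact min_le_left _ _
            _ = ε := by field_simp)
      have hmem := hmid N _ (hanti hn (hxA n)) _ (hanti hk (hxA k))
      have := Metric.infDist_le_dist_of_mem (x := a) hmem
      rw [dist_comm] at this
      exact absurd (this.trans key) (not_le.2 hN)
  obtain ⟨z, hz⟩ := cauchySeq_tendsto_of_complete hcauchy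
  refine ⟨z, Set.mem_iInter.2 fun n => (hcl n).mem_of_tendsto hz ?_⟩
  filter_upwards [Filter.eventually_ge_atTop n] with k hk using hanti hk (hxA k)

lemma isConvexMidpoint_geodesicMid [CompleteSpace Z] (hg : IsUniquelyGeodesic Z)
    (hu : IsUniformlyConvex Z) (hb : IsBusemannNPC Z) : IsConvexMidpoint (geodesicMid hg) := by
  have hm := isGeodesicMidpoint_geodesicMid hg
  -- Symmetry lets the Busemann inequality move either endpoint; the distance estimate below then
  -- passes through the midpoint of `x'` and `y`.
  have hsymm : ∀ x y, geodesicMid hg x y = geodesicMid hg y x :=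
    fun x y => (hm x y).symm.eq_geodesicMid hg
  refine ⟨hsymm, fun x y x' y' => ?_, fun x y => (hm x y).dist_left.le,
    fun g x y => ((hm x y).map g).eq_geodesicMid hg, uniformlyConvex_nested hg hu⟩
  have h1 := hb x x' y _ _ (hm x y) (hm x' y)
  have h2 := hb y y' x' _ _ (hm y x') (hm y' x')
  rw [hsymm y x', hsymm y' x'] at h2
  have := dist_triangle (geodesicMid hg x y) (geodesicMid hg x' y) (geodesicMid hg x' y')
  linarith

lemma isBounded_orbit {Γ : Type*} [Group Γ] [TopologicalSpace Γ] (ρ : Γ →* (Z ≃ᵢ Z))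
    (hρ : ∀ z : Z, Continuous fun γ : Γ => ρ γ z) {K : Subgroup Γ} (hK : IsCompact (K : Set Γ))
    (z : Z) : ∃ R : ℝ, 0 ≤ R ∧ ∀ k ∈ K, dist z (ρ k z) ≤ R := by
  obtain ⟨R, hR⟩ := (hK.image (hρ z)).isBounded.subset_closedBall z
  have h : ∀ k ∈ K, dist z (ρ k z) ≤ R := fun k hk => by
    rw [dist_comm]
    exact hR (Set.mem_image_of_mem _ hk)
  exact ⟨R, dist_nonneg.trans (h 1 K.one_mem), h⟩

/-- The fixed point is the circumcentre, relative to `A`, of a `K`-orbit. The smallest radius is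
attained by the nested intersection property, the centre is unique by uniform convexity, and `K`
preserves both the orbit and `A`. -/
lemma hasCompactFixedPoints_geodesicMid [CompleteSpace Z] (hg : IsUniquelyGeodesic Z)
    (hu : IsUniformlyConvex Z) (hb : IsBusemannNPC Z) {Γ : Type*} [Group Γ] [TopologicalSpace Γ]
    (ρ : Γ →* (Z ≃ᵢ Z)) (hρ : ∀ z : Z, Continuous fun γ : Γ => ρ γ z) :
    HasCompactFixedPoints (geodesicMid hg) ρ := by
  intro K hK A ⟨x₀, hx₀⟩ hcl hbd hmid hinv
  have hM := isConvexMidpoint_geodesicMid hg hu hb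
  obtain ⟨R₁, hR₁0, hR₁⟩ := isBounded_orbit ρ hρ hK x₀
  let B : ℝ → Set Z := fun R => {x | x ∈ A ∧ ∀ k ∈ K, dist x (ρ k x₀) ≤ R}
  let T : Set ℝ := {R | (B R).Nonempty}
  have hT0 : ∀ R ∈ T, 0 ≤ R := by
    rintro R ⟨x, -, hx⟩
    exact dist_nonneg.trans (hx 1 K.one_mem)
  have hTne : T.Nonempty := ⟨R₁, x₀, hx₀, hR₁⟩
  have hTbd : BddBelow T := ⟨0, hT0⟩
  set r := sInf T with hr
  have hr0 : 0 ≤ r := le_csInf hTne hT0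
  have hBcl : ∀ R, IsClosed (B R) := fun R => by
    have : B R = A ∩ ⋂ k ∈ K, {x | dist x (ρ k x₀) ≤ R} := by
      ext x
      simp [B]
    rw [this]
    exact hcl.inter (isClosed_biInter fun k _ =>
      isClosed_le (continuous_id.dist continuous_const) continuous_const)
  have hBmid : ∀ R, MidClosed (geodesicMid hg) (B R) := fun R x hx y hy =>
    ⟨hmid x hx.1 y hy.1, fun k hk =>
      hM.midClosed_closedBall (ρ k x₀) R x (hx.2 k hk) y (hy.2 k hk)⟩
  have hBmono : Monotone B := fun R R' hRR' x hx => ⟨hx.1, fun k hk => (hx.2 k hk).trans hRR'⟩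
  obtain ⟨x, hx⟩ := uniformlyConvex_nested hg hu (fun n : ℕ => B (r + 1 / ((n : ℝ) + 1)))
    (fun n k hnk => hBmono (by gcongr)) (fun n => by
      have hpos : (0 : ℝ) < 1 / ((n : ℝ) + 1) := by positivity
      obtain ⟨R, hR, hlt⟩ := exists_lt_of_csInf_lt hTne (lt_add_of_pos_right r hpos)
      exact hR.mono (hBmono hlt.le))
    (fun n => hBcl _) (fun n => hbd.subset fun x hx => hx.1) (fun n => hBmid _)
  have hxB : x ∈ B r := by
    refine ⟨(Set.mem_iInter.1 hx 0).1, fun k hk => ?_⟩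
    have hlim : Filter.Tendsto (fun n : ℕ => r + 1 / ((n : ℝ) + 1)) Filter.atTop (nhds (r + 0)) :=
      tendsto_one_div_add_atTop_nhds_zero_nat.const_add r
    rw [add_zero] at hlim
    exact ge_of_tendsto' hlim fun n => (Set.mem_iInter.1 hx n).2 k hk
  have huniq : ∀ y ∈ B r, y = x := by
    intro y hy
    by_contra hne
    have hd : 0 < dist y x := dist_pos.2 hne
    have h2 : dist y x ≤ 2 * r := by
      have h1 := hy.2 1 K.one_mem
      have h2 := hxB.2 1 K.one_mem
      have := dist_triangle_right y x (ρ 1 x₀)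
      linarith
    have hrpos : 0 < r := by linarith
    -- Two distinct centres would have a midpoint that is a centre of radius `(1 - δ) * r`, below
    -- the infimum.
    obtain ⟨δ, hδ, hconv⟩ := hu.exists_modulus (ε := dist y x / r) (by positivity)
      (by rwa [div_le_iff₀ hrpos])
    have : (1 - δ) * r ∈ T := by
      refine ⟨geodesicMid hg y x, hmid y hy.1 x hxB.1, fun k hk => ?_⟩
      refine hconv r hrpos _ y x _ (isGeodesicMidpoint_geodesicMid hg _ _) ?_ ?_ ?_
      · rw [dist_comm]
        exact hy.2 k hk
      · rw [dist_comm]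
        exact hxB.2 k hk
      · rw [div_mul_cancel₀ _ hrpos.ne']
    have := csInf_le hTbd this
    nlinarith
  refine ⟨x, hxB.1, fun k hk => huniq _ ⟨hinv k hk x hxB.1, fun j hj => ?_⟩⟩
  have := hxB.2 (k⁻¹ * j) (K.mul_mem (K.inv_mem hk) hj)
  rw [← (ρ k).isometry.dist_eq, ← IsometryEquiv.mul_apply, ← map_mul, mul_inv_cancel_left] at this
  exact this

end Geodesic

/-! ### Reflexive Banach spaces -/

section Banach

open MeasureTheory

variable {Z : Type*} [NormedAddCommGroup Z] [NormedSpace ℝ Z]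

/-- A missing parameter `t` on a segment lies in a maximal gap `(a, b)` of the closed set of
parameters in `A`; the midpoint of the gap would have to belong to `A`. -/
lemma convex_of_isClosed_of_midClosed {A : Set Z} (hcl : IsClosed A)
    (hmid : MidClosed (midpoint ℝ) A) : Convex ℝ A := by
  rw [convex_iff_segment_subset]
  intro x hx y hy
  rw [segment_eq_image_lineMap]
  rintro _ ⟨t, ht, rfl⟩
  by_contra hcon
  let T : Set ℝ := {s | AffineMap.lineMap x y s ∈ A}
  have hTcl : IsClosed T := hcl.preimage AffineMap.lineMap_continuous
  have h1 : IsCompact (T ∩ Set.Icc 0 t) := isCompact_Icc.inter_left hTcl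
  have h2 : IsCompact (T ∩ Set.Icc t 1) := isCompact_Icc.inter_left hTcl
  have hne1 : (T ∩ Set.Icc 0 t).Nonempty := ⟨0, by simpa [T] using hx, le_rfl, ht.1⟩
  have hne2 : (T ∩ Set.Icc t 1).Nonempty := ⟨1, by simpa [T] using hy, ht.2, le_rfl⟩
  obtain ⟨a, ⟨haT, ha⟩, hamax⟩ := h1.exists_isGreatest hne1
  obtain ⟨b, ⟨hbT, hb⟩, hbmin⟩ := h2.exists_isLeast hne2
  have hat : a ≠ t := by
    rintro rfl
    exact hcon haT
  have hbt : b ≠ t := by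
    rintro rfl
    exact hcon hbT
  have hlt1 : a < t := lt_of_le_of_ne ha.2 hat
  have hlt2 : t < b := lt_of_le_of_ne hb.1 hbt.symm
  have hm : midpoint ℝ a b ∈ T := by
    change AffineMap.lineMap x y (midpoint ℝ a b) ∈ A
    rw [AffineMap.map_midpoint]
    exact hmid _ haT _ hbT
  rw [midpoint_eq_smul_add, smul_eq_mul, invOf_eq_inv] at hm
  rcases le_total ((2 : ℝ)⁻¹ * (a + b)) t with h | h
  · have := hamax ⟨hm, by linarith [ha.1], h⟩
    linarith
  · have := hbmin ⟨hm, h, by linarith [hb.2]⟩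
    linarith

/-- In a reflexive space, decreasing sequences of nonempty bounded closed convex sets have
nonempty intersection. -/
lemma IsReflexive.nested (hr : IsReflexive Z) (A : ℕ → Set Z) (hanti : Antitone A)
    (hne : ∀ n, (A n).Nonempty) (hcl : ∀ n, IsClosed (A n))
    (hbd : ∀ n, Bornology.IsBounded (A n)) (hconv : ∀ n, Convex ℝ (A n)) :
    (⋂ n, A n).Nonempty := by
  choose x hx using hne
  obtain ⟨B, hB⟩ := (hbd 0).subset_closedBall 0
  -- By Banach–Alaoglu the bounded sequence has a weak-* limit along a nonprincipal ultrafilter, so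
  -- no weakly convergent subsequence is needed. Reflexivity brings the limit back to `Z`, and
  -- Hahn–Banach separation puts it in each `A N`.
  let U : Ultrafilter ℕ := Filter.hyperfilter ℕ
  let j : ℕ → WeakDual ℝ (StrongDual ℝ Z) := fun n =>
    StrongDual.toWeakDual (NormedSpace.inclusionInDoubleDual ℝ Z (x n))
  have hj : ∀ n, j n ∈ WeakDual.toStrongDual ⁻¹'
      Metric.closedBall (0 : StrongDual ℝ (StrongDual ℝ Z)) B := fun n => by
    have h1 : ‖x n‖ ≤ B := by simpa using hB (hanti (Nat.zero_le n) (hx n))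
    have h2 := (NormedSpace.double_dual_bound ℝ Z (x n)).trans h1
    exact (mem_closedBall_zero_iff (E := StrongDual ℝ (StrongDual ℝ Z))).2 h2
  obtain ⟨ℓ, -, hℓ⟩ := (WeakDual.isCompact_closedBall (𝕜 := ℝ) _ B).ultrafilter_le_nhds
    (U.map j) (by
      rw [Filter.le_principal_iff, Ultrafilter.coe_map, Filter.mem_map]
      exact Filter.univ_mem' hj)
  obtain ⟨z, hz⟩ := hr (WeakDual.toStrongDual ℓ)
  have hlim : ∀ g : StrongDual ℝ Z, Filter.Tendsto (fun n => g (x n)) U (nhds (g z)) := by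
    intro g
    have h1 : Filter.Tendsto j U (nhds ℓ) := hℓ
    have h2 := ((WeakDual.eval_continuous g).tendsto ℓ).comp h1
    have h3 : ℓ g = g z := by
      have := congrArg (fun L => L g) hz
      simpa using this.symm
    rw [h3] at h2
    exact h2
  refine ⟨z, Set.mem_iInter.2 fun N => ?_⟩
  by_contra hzN
  obtain ⟨g, c, hzc, hc⟩ := geometric_hahn_banach_point_closed (hconv N) (hcl N) hzN
  have hev : ∀ᶠ n in (U : Filter ℕ), c ≤ g (x n) := by
    have : ∀ᶠ n in Filter.cofinite, N ≤ n := by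
      rw [Nat.cofinite_eq_atTop]
      exact Filter.eventually_ge_atTop N
    have hle : (U : Filter ℕ) ≤ Filter.cofinite := Filter.hyperfilter_le_cofinite
    exact (this.filter_mono hle).mono fun n hn => (hc _ (hanti hn (hx n))).le
  exact absurd (ge_of_tendsto (hlim g) hev) (not_le.2 hzc)

lemma IsReflexive.isConvexMidpoint (hr : IsReflexive Z) :
    IsConvexMidpoint (midpoint ℝ : Z → Z → Z) where
  symm x y := midpoint_comm x y
  dist_mid_mid_le x y x' y' := dist_midpoint_midpoint_le x y x' y'
  dist_left_le x y := by
    rw [dist_left_midpoint, Real.norm_ofNat]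
    linarith
  -- This is the Mazur–Ulam theorem.
  map_mid g x y := g.map_midpoint x y
  nested A hanti hne hcl hbd hmid := hr.nested A hanti hne hcl hbd
    fun n => convex_of_isClosed_of_midClosed (hcl n) (hmid n)

/-- Averaging over a compact group. -/
lemma hasCompactFixedPoints_midpoint [CompleteSpace Z] {Γ : Type*} [Group Γ] [TopologicalSpace Γ]
    [IsTopologicalGroup Γ] (ρ : Γ →* (Z ≃ᵢ Z)) (hρ : ∀ z : Z, Continuous fun γ : Γ => ρ γ z) :
    HasCompactFixedPoints (midpoint ℝ) ρ := by
  intro K hK A ⟨x, hx⟩ hcl hbd hmid hinv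
  have hcomp : CompactSpace K := isCompact_iff_compactSpace.1 hK
  let : MeasurableSpace K := borel K
  have : BorelSpace K := ⟨rfl⟩
  let μ₀ : Measure K := Measure.haarMeasure ⊤
  have hprob : IsProbabilityMeasure μ₀ := ⟨Measure.haarMeasure_self⟩
  have hcont : ∀ y, Continuous fun k : K => ρ k y := fun y => (hρ y).comp continuous_subtype_val
  have hint : ∀ y, Integrable (fun k : K => ρ k y) μ₀ := fun y =>
    (hcont y).integrable_of_hasCompactSupport (HasCompactSupport.of_compactSpace _)
  refine ⟨∫ k : K, ρ k x ∂μ₀, ?_, fun h hh => ?_⟩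
  · exact (convex_of_isClosed_of_midClosed hcl hmid).integral_mem hcl
      (Filter.Eventually.of_forall fun k => hinv k k.2 x hx) (hint x)
  -- By Mazur–Ulam `ρ h` is affine, hence commutes with integration against a probability measure;
  -- left invariance of Haar measure then absorbs `h`.
  · let g := (ρ h).toRealAffineIsometryEquiv
    have hg : ∀ z, ρ h z = g.linearIsometryEquiv z + ρ h 0 := fun z => by
      have := g.map_vadd 0 z
      simpa [g] using this
    calc ρ h (∫ k : K, ρ k x ∂μ₀)
        = g.linearIsometryEquiv (∫ k : K, ρ k x ∂μ₀) + ρ h 0 := hg _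
      _ = ∫ k : K, g.linearIsometryEquiv (ρ k x) ∂μ₀ + ρ h 0 := by
          congr 1
          exact (g.linearIsometryEquiv.toContinuousLinearEquiv.integral_comp_comm _).symm
      _ = ∫ k : K, (g.linearIsometryEquiv (ρ k x) + ρ h 0) ∂μ₀ := by
          rw [integral_add]
          · simp
          · exact g.linearIsometryEquiv.toContinuousLinearEquiv.toContinuousLinearMap.integrable_comp
              (hint x)
          · exact integrable_const _
      _ = ∫ k : K, ρ ((⟨h, hh⟩ * k : K) : Γ) x ∂μ₀ := by
          refine integral_congr_ae (Filter.Eventually.of_forall fun k => ?_)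
          simp only [← hg]
          rw [Subgroup.coe_mul, map_mul]
          rfl
      _ = ∫ k : K, ρ k x ∂μ₀ :=
          integral_mul_left_eq_self (fun k : K => ρ k x) (⟨h, hh⟩ : K)

end Banach

/-! ### Properties of the energy function -/

namespace IsEnergyFunction

variable {f : ℝ → ℝ}

lemma nonneg (hf : IsEnergyFunction f) {t : ℝ} (ht : 0 ≤ t) : 0 ≤ f t := by
  rw [← hf.map_zero]
  exact hf.strictMono.monotoneOn Set.self_mem_Ici ht ht

lemma mono (hf : IsEnergyFunction f) {s t : ℝ} (hs : 0 ≤ s) (hst : s ≤ t) : f s ≤ f t :=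
  hf.strictMono.monotoneOn hs (hs.trans hst) hst

lemma map_one_pos (hf : IsEnergyFunction f) : 0 < f 1 := by
  rw [← hf.map_zero]
  exact hf.strictMono Set.self_mem_Ici (zero_le_one' ℝ) one_pos

lemma midpoint_le (hf : IsEnergyFunction f) {s t : ℝ} (hs : 0 ≤ s) (ht : 0 ≤ t) :
    f ((s + t) / 2) ≤ (f s + f t) / 2 := by
  have := hf.strictConvex.convexOn.2 hs ht (by norm_num : (0 : ℝ) ≤ 1 / 2)
    (by norm_num : (0 : ℝ) ≤ 1 / 2) (by norm_num)
  simp only [smul_eq_mul] at this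
  rw [← mul_add, ← mul_add, one_div, inv_mul_eq_div, inv_mul_eq_div] at this
  exact this

lemma map_mul_le (hf : IsEnergyFunction f) {c t : ℝ} (hc : 0 ≤ c) (hc1 : c ≤ 1) (ht : 0 ≤ t) :
    f (c * t) ≤ c * f t := by
  have := hf.strictConvex.convexOn.2 (show t ∈ Set.Ici 0 from ht) Set.self_mem_Ici hc
    (by linarith : 0 ≤ 1 - c) (by ring)
  simpa [hf.map_zero] using this

/-- Convexity with `f 0 = 0` forces at least linear growth; this makes `f` onto `[0, ∞)` and bounds
sublevel sets of energies. -/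
lemma mul_le_map (hf : IsEnergyFunction f) {t : ℝ} (ht : 1 ≤ t) : t * f 1 ≤ f t := by
  have h0 : 0 < t := by linarith
  have := hf.map_mul_le (c := t⁻¹) (t := t) (by positivity) (inv_le_one_of_one_le₀ ht) h0.le
  rwa [inv_mul_cancel₀ h0.ne', ← div_eq_inv_mul, le_div_iff₀' h0] at this

/-- Convexity gives continuity only in the interior; at `0` it follows from `0 ≤ f t ≤ t * f 1`. -/
lemma continuousOn (hf : IsEnergyFunction f) : ContinuousOn f (Set.Ici 0) := by
  intro t ht
  rcases (show (0 : ℝ) ≤ t from ht).eq_or_lt with rfl | hpos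
  · have hlim : Filter.Tendsto (fun t : ℝ => t * f 1) (nhdsWithin 0 (Set.Ici 0)) (nhds (f 0)) := by
      have : Filter.Tendsto (fun t : ℝ => t * f 1) (nhds 0) (nhds (0 * f 1)) :=
        (continuous_id.mul continuous_const).tendsto 0
      rw [zero_mul] at this
      rw [hf.map_zero]
      exact this.mono_left nhdsWithin_le_nhds
    refine tendsto_of_tendsto_of_tendsto_of_le_of_le' tendsto_const_nhds hlim ?_ ?_
    · filter_upwards [self_mem_nhdsWithin] with t ht
      rw [hf.map_zero]
      exact hf.nonneg ht
    · filter_upwards [self_mem_nhdsWithin, mem_nhdsWithin_of_mem_nhds (Iic_mem_nhds one_pos)]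
        with t ht ht1
      simpa using hf.map_mul_le (c := t) (t := 1) ht ht1 zero_le_one
  · have h1 := (hf.strictConvex.convexOn.subset Set.Ioi_subset_Ici_self (convex_Ioi 0)).continuousOn
      isOpen_Ioi
    exact (h1.continuousAt (Ioi_mem_nhds hpos)).continuousWithinAt

lemma continuous_dist {Z : Type*} [MetricSpace Z] (hf : IsEnergyFunction f) (z : Z) :
    Continuous fun x => f (dist x z) :=
  hf.continuousOn.comp_continuous (continuous_id.dist continuous_const) fun _ => dist_nonneg

lemma le_invFunOn (hf : IsEnergyFunction f) {t y : ℝ} (ht : 0 ≤ t) (hy : f t ≤ y) :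
    t ≤ Function.invFunOn f (Set.Ici 0) y := by
  have hy0 : 0 ≤ y := (hf.nonneg ht).trans hy
  -- Surjectivity onto `[0, ∞)` ensures that `invFunOn` is a genuine inverse at `y` and not a
  -- default value.
  have hmem : ∃ s ∈ Set.Ici (0 : ℝ), f s = y := by
    set T := max 1 (y / f 1)
    have hT : y ≤ f T := by
      refine le_trans ?_ (hf.mul_le_map (le_max_left _ _))
      rw [← div_le_iff₀ hf.map_one_pos]
      exact le_max_right _ _
    have hT0 : 0 ≤ T := zero_le_one.trans (le_max_left _ _)
    have := intermediate_value_Icc hT0 (hf.continuousOn.mono Set.Icc_subset_Ici_self)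
    obtain ⟨s, hs, hfs⟩ := this ⟨by rwa [hf.map_zero], hT⟩
    exact ⟨s, hs.1, hfs⟩
  have h1 := Function.invFunOn_mem hmem
  have h2 := Function.invFunOn_eq hmem
  rw [← h2] at hy
  exact (hf.strictMono.le_iff_le ht h1).1 hy

end IsEnergyFunction

/-- Weights on the oriented edges and triangles of a complex, extended by zero. The finset `N u`
consists of the neighbours of `u`. -/
structure IsLinkWeight {V : Type*} (Γ : Type*) [Group Γ] [MulAction Γ V] (N : V → Finset V)
    (a : V → V → ℝ) (b : V → V → V → ℝ) (C : ℝ) : Prop where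
  a_nonneg : ∀ u v, 0 ≤ a u v
  a_symm : ∀ u v, a u v = a v u
  a_smul : ∀ (γ : Γ) u v, a (γ • u) (γ • v) = a u v
  mem_iff : ∀ u v, v ∈ N u ↔ a u v ≠ 0
  nonempty : ∀ u, (N u).Nonempty
  b_nonneg : ∀ u v w, 0 ≤ b u v w
  b_swap : ∀ u v w, b u v w = b v u w
  b_smul : ∀ (γ : Γ) u v w, b (γ • u) (γ • v) (γ • w) = b u v w
  mem_of_b : ∀ u v w, b u v w ≠ 0 → v ∈ N u ∧ w ∈ N u
  sum_b : ∀ v w, ∑ u ∈ N v, b u v w = C * a v w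

/-! ### Equivariant selections -/

section Selection

variable {V Γ Z : Type*} [Group Γ] [MulAction Γ V] [MetricSpace Z]

/-- `φ` is equivariant with respect to the isometric action `ρ`. -/
def IsEquivariant (ρ : Γ →* (Z ≃ᵢ Z)) (φ : V → Z) : Prop :=
  ∀ (γ : Γ) u, φ (γ • u) = ρ γ (φ u)

/-- Choose a stabilizer-fixed point at one representative of each orbit and transport it. Two
elements carrying the representative to the same vertex differ by the stabilizer, so the choice of
transporter is harmless. -/
lemma exists_isEquivariant (ρ : Γ →* (Z ≃ᵢ Z)) (S : V → Set Z)
    (hS : ∀ (γ : Γ) u x, x ∈ S u → ρ γ x ∈ S (γ • u))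
    (hfix : ∀ u, ∃ x ∈ S u, ∀ k ∈ MulAction.stabilizer Γ u, ρ k x = x) :
    ∃ φ : V → Z, IsEquivariant ρ φ ∧ ∀ u, φ u ∈ S u := by
  choose p hpS hp using hfix
  let q : V → MulAction.orbitRel.Quotient Γ V := Quotient.mk''
  have hq : ∀ u : V, ∃ γ : Γ, γ • (q u).out = u := fun u => by
    have : u ∈ MulAction.orbit Γ (q u).out := by
      rw [MulAction.mem_orbit_symm]
      exact Quotient.exact (s := MulAction.orbitRel Γ V) (Quotient.out_eq (q u))
    exact this
  choose g hg using hq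
  refine ⟨fun u => ρ (g u) (p (q u).out), fun γ u => ?_, fun u => ?_⟩
  · have hqu : q (γ • u) = q u :=
      Quotient.sound (s := MulAction.orbitRel Γ V) (MulAction.mem_orbit u γ)
    have h1 := hg (γ • u)
    rw [hqu] at h1
    have h2 := hp (q u).out ((γ * g u)⁻¹ * g (γ • u)) (by
      rw [MulAction.mem_stabilizer_iff, mul_smul, h1, inv_smul_eq_iff, mul_smul, hg])
    simp only [hqu]
    calc ρ (g (γ • u)) (p (q u).out)
        = ρ ((γ * g u) * ((γ * g u)⁻¹ * g (γ • u))) (p (q u).out) := by rw [mul_inv_cancel_left]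
      _ = ρ γ (ρ (g u) (ρ ((γ * g u)⁻¹ * g (γ • u)) (p (q u).out))) := by
          simp only [map_mul, IsometryEquiv.mul_apply]
      _ = ρ γ (ρ (g u) (p (q u).out)) := by rw [h2]
  · have := hS (g u) _ _ (hpS (q u).out)
    rwa [hg] at this

end Selection

/-! ### Local energies and their minimizers -/

section Energies

variable {V Γ Z : Type*} [Group Γ] [MulAction Γ V] [MetricSpace Z]
  {N : V → Finset V} {a : V → V → ℝ} {b : V → V → V → ℝ} {C : ℝ} {f : ℝ → ℝ}

/-- The energy of the point `ξ` with respect to the restriction of `φ` to the link of `u`. -/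
noncomputable def localEnergy (N : V → Finset V) (a : V → V → ℝ) (f : ℝ → ℝ) (u : V) (φ : V → Z)
    (ξ : Z) : ℝ :=
  ∑ v ∈ N u, a u v * f (dist ξ (φ v))

/-- The energy of the restriction of `φ` to the link of `u`. -/
noncomputable def localLinkEnergy (N : V → Finset V) (b : V → V → V → ℝ) (f : ℝ → ℝ) (u : V)
    (φ : V → Z) : ℝ :=
  ∑ v ∈ N u, ∑ w ∈ N u, b u v w / 2 * f (dist (φ v) (φ w))

namespace IsLinkWeight

lemma constant_nonneg (hW : IsLinkWeight Γ N a b C) [Nonempty V] : 0 ≤ C := by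
  obtain ⟨v⟩ := ‹Nonempty V›
  obtain ⟨w, hw⟩ := hW.nonempty v
  have h1 := (hW.a_nonneg v w).lt_of_ne' ((hW.mem_iff v w).1 hw)
  have h2 : 0 ≤ C * a v w := by
    rw [← hW.sum_b]
    exact Finset.sum_nonneg fun u _ => hW.b_nonneg _ _ _
  exact nonneg_of_mul_nonneg_left h2 h1

lemma smul_mem (hW : IsLinkWeight Γ N a b C) (γ : Γ) {u v : V} (h : v ∈ N u) :
    γ • v ∈ N (γ • u) := by
  rw [hW.mem_iff] at *
  rwa [hW.a_smul]

lemma a_pos (hW : IsLinkWeight Γ N a b C) {u v : V} (h : v ∈ N u) : 0 < a u v :=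
  (hW.a_nonneg u v).lt_of_ne' ((hW.mem_iff u v).1 h)

lemma term_nonneg (hW : IsLinkWeight Γ N a b C) (hf : IsEnergyFunction f) (u v : V) (x y : Z) :
    0 ≤ a u v * f (dist x y) :=
  mul_nonneg (hW.a_nonneg u v) (hf.nonneg dist_nonneg)

lemma localEnergy_nonneg (hW : IsLinkWeight Γ N a b C) (hf : IsEnergyFunction f) (u : V)
    (φ : V → Z) (ξ : Z) : 0 ≤ localEnergy N a f u φ ξ :=
  Finset.sum_nonneg fun _ _ => hW.term_nonneg hf _ _ _ _

lemma le_localEnergy (hW : IsLinkWeight Γ N a b C) (hf : IsEnergyFunction f) {u v : V}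
    (hv : v ∈ N u) (φ : V → Z) (ξ : Z) :
    a u v * f (dist ξ (φ v)) ≤ localEnergy N a f u φ ξ :=
  Finset.single_le_sum (f := fun v => a u v * f (dist ξ (φ v)))
    (fun _ _ => hW.term_nonneg hf _ _ _ _) hv

lemma localEnergy_smul (hW : IsLinkWeight Γ N a b C) {ρ : Γ →* (Z ≃ᵢ Z)} {φ : V → Z}
    (hφ : IsEquivariant ρ φ) (γ : Γ) (u : V) (ξ : Z) :
    localEnergy N a f (γ • u) φ (ρ γ ξ) = localEnergy N a f u φ ξ := by
  symm
  refine Finset.sum_nbij' (γ • ·) (γ⁻¹ • ·) (fun v hv => hW.smul_mem γ hv)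
    (fun v hv => by simpa using hW.smul_mem γ⁻¹ hv) (by simp) (by simp) fun v _ => ?_
  rw [hW.a_smul, hφ, (ρ γ).dist_eq]

lemma continuous_localEnergy (hf : IsEnergyFunction f) (u : V) (φ : V → Z) :
    Continuous (localEnergy N a f u φ) :=
  continuous_finsetSum _ fun v _ => continuous_const.mul (hf.continuous_dist (φ v))

lemma localEnergy_mid_le (hW : IsLinkWeight Γ N a b C) (hf : IsEnergyFunction f)
    {mid : Z → Z → Z} (hM : IsConvexMidpoint mid) (u : V) (φ : V → Z) (x y : Z) :
    localEnergy N a f u φ (mid x y) ≤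
      (localEnergy N a f u φ x + localEnergy N a f u φ y) / 2 := by
  unfold localEnergy
  rw [← Finset.sum_add_distrib, Finset.sum_div]
  refine Finset.sum_le_sum fun v _ => ?_
  have h1 := (hf.mono dist_nonneg (hM.dist_mid_le x y (φ v))).trans
    (hf.midpoint_le dist_nonneg dist_nonneg)
  have := mul_le_mul_of_nonneg_left h1 (hW.a_nonneg u v)
  linarith

lemma isBounded_sublevel (hW : IsLinkWeight Γ N a b C) (hf : IsEnergyFunction f) (u : V)
    (φ : V → Z) (c : ℝ) : Bornology.IsBounded {x | localEnergy N a f u φ x ≤ c} := by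
  obtain ⟨v, hv⟩ := hW.nonempty u
  refine (Metric.isBounded_closedBall (x := φ v) (r := max 1 (c / a u v / f 1))).subset
    fun x hx => ?_
  rw [Metric.mem_closedBall]
  rcases le_total (dist x (φ v)) 1 with h | h
  · exact h.trans (le_max_left _ _)
  · refine le_trans ?_ (le_max_right _ _)
    rw [le_div_iff₀ hf.map_one_pos, le_div_iff₀' (hW.a_pos hv)]
    exact (mul_le_mul_of_nonneg_left (hf.mul_le_map h) (hW.a_nonneg u v)).trans
      ((hW.le_localEnergy hf hv φ x).trans hx)

/-- The sublevel sets just above the infimum are closed, bounded and midpoint-closed, so the nested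
intersection property replaces compactness. -/
lemma exists_minimizer [Nonempty Z] (hW : IsLinkWeight Γ N a b C) (hf : IsEnergyFunction f)
    {mid : Z → Z → Z} (hM : IsConvexMidpoint mid) (u : V) (φ : V → Z) :
    ∃ ξ, ∀ ζ, localEnergy N a f u φ ξ ≤ localEnergy N a f u φ ζ := by
  set E := localEnergy N a f u φ
  have hbdd : BddBelow (Set.range E) :=
    ⟨0, by rintro _ ⟨x, rfl⟩; exact hW.localEnergy_nonneg hf u φ x⟩
  set e := ⨅ x, E x
  obtain ⟨ξ, hξ⟩ := hM.nested (fun n : ℕ => {x | E x ≤ e + 1 / ((n : ℝ) + 1)})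
    (fun n k hnk x hx => le_trans (show E x ≤ _ from hx) (by gcongr))
    (fun n => by
      have hpos : (0 : ℝ) < 1 / ((n : ℝ) + 1) := by positivity
      obtain ⟨x, hx⟩ := exists_lt_of_ciInf_lt (lt_add_of_pos_right e hpos)
      exact ⟨x, hx.le⟩)
    (fun n => isClosed_le (continuous_localEnergy hf u φ) continuous_const)
    (fun n => hW.isBounded_sublevel hf u φ _)
    (fun n x hx y hy => by
      have h1 : E x ≤ _ := hx
      have h2 : E y ≤ _ := hy
      have := hW.localEnergy_mid_le hf hM u φ x y
      change E _ ≤ _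
      linarith)
  refine ⟨ξ, fun ζ => le_trans ?_ (ciInf_le hbdd ζ)⟩
  have hlim : Filter.Tendsto (fun n : ℕ => e + 1 / ((n : ℝ) + 1)) Filter.atTop (nhds (e + 0)) :=
    tendsto_one_div_add_atTop_nhds_zero_nat.const_add e
  rw [add_zero] at hlim
  exact ge_of_tendsto' hlim fun n => Set.mem_iInter.1 hξ n

/-- An equivariant choice of minimizers. -/
lemma exists_isEquivariant_minimizer [Nonempty Z] [TopologicalSpace Γ]
    (hW : IsLinkWeight Γ N a b C)
    (hf : IsEnergyFunction f) {mid : Z → Z → Z} (hM : IsConvexMidpoint mid)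
    {ρ : Γ →* (Z ≃ᵢ Z)} (hfix : HasCompactFixedPoints mid ρ)
    (hproper : IsProperlyDiscontinuousAction V Γ) {φ : V → Z} (hφ : IsEquivariant ρ φ) :
    ∃ χ : V → Z, IsEquivariant ρ χ ∧
      ∀ u ζ, localEnergy N a f u φ (χ u) ≤ localEnergy N a f u φ ζ := by
  have hS : ∀ (γ : Γ) u x, (∀ ζ, localEnergy N a f u φ x ≤ localEnergy N a f u φ ζ) →
      ∀ ζ, localEnergy N a f (γ • u) φ (ρ γ x) ≤ localEnergy N a f (γ • u) φ ζ := by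
    intro γ u x hx ζ
    rw [hW.localEnergy_smul hφ, ← (ρ γ).apply_symm_apply ζ, hW.localEnergy_smul hφ]
    exact hx _
  refine exists_isEquivariant ρ
    (fun u => {ξ | ∀ ζ, localEnergy N a f u φ ξ ≤ localEnergy N a f u φ ζ}) hS fun u => ?_
  obtain ⟨ξ, hξ⟩ := hW.exists_minimizer hf hM u φ
  -- Minimizers need not be unique, so an arbitrary one may be moved by the stabilizer of `u`; the
  -- set of all minimizers is invariant and contains a fixed one.
  refine hfix _ (hproper u).1 _ ⟨ξ, hξ⟩ ?_ ?_ ?_ ?_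
  · have : {ξ | ∀ ζ, localEnergy N a f u φ ξ ≤ localEnergy N a f u φ ζ} =
        ⋂ ζ, {ξ | localEnergy N a f u φ ξ ≤ localEnergy N a f u φ ζ} := by
      ext
      simp
    rw [this]
    exact isClosed_iInter fun ζ => isClosed_le (continuous_localEnergy hf u φ) continuous_const
  · exact (hW.isBounded_sublevel hf u φ (localEnergy N a f u φ ξ)).subset fun x hx => hx ξ
  · intro x hx y hy ζ
    have := hW.localEnergy_mid_le hf hM u φ x y
    linarith [hx ζ, hy ζ]
  · intro k hk x hx
    have := hS k u x hx
    rwa [MulAction.mem_stabilizer_iff.1 hk] at this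

end IsLinkWeight

/-- At each vertex, equal balls centred on the stabilizer orbit of a point `z`, with radius bounding
that orbit, intersect in a bounded convex invariant set containing `z`. -/
lemma exists_isEquivariant_map [Nonempty Z] [TopologicalSpace Γ]
    {mid : Z → Z → Z} (hM : IsConvexMidpoint mid)
    {ρ : Γ →* (Z ≃ᵢ Z)} (hρ : ∀ z : Z, Continuous fun γ : Γ => ρ γ z)
    (hfix : HasCompactFixedPoints mid ρ)
    (hproper : IsProperlyDiscontinuousAction V Γ) : ∃ φ : V → Z, IsEquivariant ρ φ := by
  obtain ⟨z⟩ := ‹Nonempty Z›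
  have := exists_isEquivariant (V := V) ρ (fun _ => Set.univ) (fun _ _ _ _ => Set.mem_univ _)
    fun u => by
      obtain ⟨R, -, hR⟩ := isBounded_orbit ρ hρ (hproper u).1 z
      obtain ⟨x, -, hx⟩ := hfix _ (hproper u).1
        (⋂ k ∈ MulAction.stabilizer Γ u, Metric.closedBall (ρ k z) R)
        ⟨z, by simpa using hR⟩
        (isClosed_biInter fun k _ => Metric.isClosed_closedBall)
        ((Metric.isBounded_closedBall (x := ρ 1 z) (r := R)).subset
          (Set.biInter_subset_of_mem (one_mem _)))
        (fun x hx y hy => by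
          rw [Set.mem_iInter₂] at *
          exact fun k hk => hM.midClosed_closedBall _ _ x (hx k hk) y (hy k hk))
        (fun k hk x hx => by
          rw [Set.mem_iInter₂] at *
          intro j hj
          have := hx (k⁻¹ * j) (mul_mem (inv_mem hk) hj)
          rwa [Metric.mem_closedBall, ← (ρ k).dist_eq, ← IsometryEquiv.mul_apply (ρ k), ← map_mul,
            mul_inv_cancel_left] at this)
      exact ⟨x, Set.mem_univ x, hx⟩
  exact ⟨this.choose, this.choose_spec.1⟩

end Energies

/-! ### The total energy and its contraction -/

section TotalEnergy

open MeasureTheory Filter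

variable {V Γ Z : Type*} [Group Γ] [MulAction Γ V] [MetricSpace Z]
  {N : V → Finset V} {a : V → V → ℝ} {b : V → V → V → ℝ} {C : ℝ} {f : ℝ → ℝ}

namespace IsLinkWeight

lemma tsum_ofReal_mul (hW : IsLinkWeight Γ N a b C) (u : V) {g : V → ℝ} (hg : ∀ v, 0 ≤ g v) :
    ∑' v, ENNReal.ofReal (a u v * g v) = ENNReal.ofReal (∑ v ∈ N u, a u v * g v) := by
  rw [tsum_eq_sum (s := N u), ENNReal.ofReal_sum_of_nonneg]
  · exact fun v _ => mul_nonneg (hW.a_nonneg u v) (hg v)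
  · intro v hv
    rw [hW.mem_iff, not_not] at hv
    simp [hv]

lemma tsum_tsum_ofReal_mul (hW : IsLinkWeight Γ N a b C) (u : V) {g : V → V → ℝ}
    (hg : ∀ v w, 0 ≤ g v w) :
    ∑' v, ∑' w, ENNReal.ofReal (b u v w * g v w) =
      ENNReal.ofReal (∑ v ∈ N u, ∑ w ∈ N u, b u v w * g v w) := by
  have hb : ∀ v w, v ∉ N u ∨ w ∉ N u → b u v w = 0 := fun v w h => by
    by_contra h0
    have := hW.mem_of_b u v w h0
    tauto
  have h1 : ∀ v w, 0 ≤ b u v w * g v w := fun v w => mul_nonneg (hW.b_nonneg u v w) (hg v w)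
  rw [tsum_eq_sum (s := N u), ENNReal.ofReal_sum_of_nonneg fun v _ => Finset.sum_nonneg
    fun w _ => h1 v w]
  · refine Finset.sum_congr rfl fun v _ => ?_
    rw [tsum_eq_sum (s := N u), ENNReal.ofReal_sum_of_nonneg fun w _ => h1 v w]
    intro w hw
    simp [hb v w (.inr hw)]
  · intro v hv
    simp [hb v _ (.inl hv)]

lemma tsum_eq_localEnergy (hW : IsLinkWeight Γ N a b C) (hf : IsEnergyFunction f)
    (φ χ : V → Z) (u : V) : ∑' v, ENNReal.ofReal (a u v * f (dist (φ u) (χ v))) =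
      ENNReal.ofReal (localEnergy N a f u χ (φ u)) :=
  hW.tsum_ofReal_mul u fun _ => hf.nonneg dist_nonneg

/-- Energy controls displacement: compare `φ u` and `χ u` through one neighbour value `φ v`, to
which both are close on account of their local energies. -/
lemma map_dist_mid_le (hW : IsLinkWeight Γ N a b C) (hf : IsEnergyFunction f)
    {mid : Z → Z → Z} (hM : IsConvexMidpoint mid) {φ χ : V → Z} {u v : V} (hv : v ∈ N u)
    (hχ : localEnergy N a f u φ (χ u) ≤ localEnergy N a f u φ (φ u)) :
    a u v * f (dist (φ u) (mid (φ u) (χ u))) ≤ localEnergy N a f u φ (φ u) := by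
  have h1 : dist (φ u) (mid (φ u) (χ u)) ≤ (dist (φ u) (φ v) + dist (χ u) (φ v)) / 2 := by
    have := hM.dist_left_le (φ u) (χ u)
    have := dist_triangle_right (φ u) (χ u) (φ v)
    linarith
  have h2 := (hf.mono dist_nonneg h1).trans (hf.midpoint_le dist_nonneg dist_nonneg)
  have h3 := mul_le_mul_of_nonneg_left h2 (hW.a_nonneg u v)
  have h4 := hW.le_localEnergy hf hv φ (φ u)
  have h5 := hW.le_localEnergy hf hv φ (χ u)
  linarith

end IsLinkWeight

variable [MeasurableSpace Γ]

lemma orbitSum_mono {μ : Measure Γ} {R : Finset V} {F G : V → ENNReal} (h : ∀ u, F u ≤ G u) :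
    orbitSum μ R F ≤ orbitSum μ R G :=
  Finset.sum_le_sum fun r _ => mul_le_mul_right (h r) _

lemma orbitSum_const_mul {μ : Measure Γ} {R : Finset V} (c : ENNReal) (F : V → ENNReal) :
    orbitSum μ R (fun u => c * F u) = c * orbitSum μ R F := by
  unfold orbitSum
  rw [Finset.mul_sum]
  exact Finset.sum_congr rfl fun r _ => mul_left_comm _ _ _

lemma orbitSum_add {μ : Measure Γ} {R : Finset V} (F G : V → ENNReal) :
    orbitSum μ R (fun u => F u + G u) = orbitSum μ R F + orbitSum μ R G := by
  unfold orbitSum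
  rw [← Finset.sum_add_distrib]
  exact Finset.sum_congr rfl fun r _ => mul_add _ _ _

/-- The energy of a pair of equivariant maps. -/
noncomputable def totalEnergy (μ : Measure Γ) (R : Finset V) (a : V → V → ℝ) (f : ℝ → ℝ)
    (φ χ : V → Z) : ENNReal :=
  orbitSum μ R fun u => ∑' v, ENNReal.ofReal (a u v * f (dist (φ u) (χ v)))

namespace IsLinkWeight

variable [TopologicalSpace Γ]

lemma totalEnergy_ne_top [IsTopologicalGroup Γ] [BorelSpace Γ] (hW : IsLinkWeight Γ N a b C)
    (hf : IsEnergyFunction f) (μ : Measure Γ) [μ.IsHaarMeasure]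
    (hproper : IsProperlyDiscontinuousAction V Γ) (R : Finset V) (φ χ : V → Z) :
    totalEnergy μ R a f φ χ ≠ ⊤ := by
  refine (ENNReal.sum_lt_top.2 fun r _ => ?_).ne
  simp only [hW.tsum_eq_localEnergy hf]
  exact ENNReal.mul_lt_top (ENNReal.inv_lt_top.2
    (measure_stabilizer_ne_zero μ hproper r).bot_lt) ENNReal.ofReal_lt_top

/-- The local energies are controlled by the total energy. -/
lemma exists_localEnergy_le [IsTopologicalGroup Γ] [BorelSpace Γ] (hW : IsLinkWeight Γ N a b C)
    (hf : IsEnergyFunction f) (μ : Measure Γ) [μ.IsHaarMeasure]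
    (hproper : IsProperlyDiscontinuousAction V Γ) {R : Finset V} (hR : IsOrbitTransversal Γ R)
    (ρ : Γ →* (Z ≃ᵢ Z)) (u : V) :
    ∃ K : ℝ, 0 ≤ K ∧ ∀ φ : V → Z, IsEquivariant ρ φ →
      localEnergy N a f u φ (φ u) ≤ K * (totalEnergy μ R a f φ φ).toReal := by
  obtain ⟨r, ⟨hr, γ, rfl⟩, -⟩ := hR u
  refine ⟨(μ (MulAction.stabilizer Γ r : Set Γ)).toReal, ENNReal.toReal_nonneg, fun φ hφ => ?_⟩
  change localEnergy N a f (γ • r) φ (φ (γ • r)) ≤ _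
  rw [hφ, hW.localEnergy_smul hφ, ← ENNReal.toReal_mul]
  have h0 := measure_stabilizer_ne_zero μ hproper r
  have ht := measure_stabilizer_ne_top μ hproper r
  have h1 : (μ (MulAction.stabilizer Γ r : Set Γ))⁻¹ * ENNReal.ofReal (localEnergy N a f r φ (φ r))
      ≤ totalEnergy μ R a f φ φ := by
    rw [← hW.tsum_eq_localEnergy hf]
    exact Finset.single_le_sum (f := fun r => (μ (MulAction.stabilizer Γ r : Set Γ))⁻¹ *
      ∑' v, ENNReal.ofReal (a r v * f (dist (φ r) (φ v)))) (fun _ _ => zero_le) hr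
  refine (ENNReal.ofReal_le_iff_le_toReal
    (ENNReal.mul_ne_top ht (hW.totalEnergy_ne_top hf μ hproper R φ φ))).1 ?_
  calc _ = μ (MulAction.stabilizer Γ r : Set Γ) * ((μ (MulAction.stabilizer Γ r : Set Γ))⁻¹ *
        ENNReal.ofReal (localEnergy N a f r φ (φ r))) := by
        rw [← mul_assoc, ENNReal.mul_inv_cancel h0 ht, one_mul]
    _ ≤ _ := mul_le_mul_right h1 _

section Unimodular

variable [IsTopologicalGroup Γ] [LocallyCompactSpace Γ] [BorelSpace Γ]

/-- Mass transport along edges, combined with the symmetry of the edge weight and of the distance.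
-/
lemma totalEnergy_comm (hW : IsLinkWeight Γ N a b C)
    (hunimod : ∀ γ : Γ, Measure.modularCharacter γ = 1) (μ : Measure Γ) [μ.IsHaarMeasure]
    (hproper : IsProperlyDiscontinuousAction V Γ) {R : Finset V} (hR : IsOrbitTransversal Γ R)
    {ρ : Γ →* (Z ≃ᵢ Z)} {φ χ : V → Z} (hφ : IsEquivariant ρ φ) (hχ : IsEquivariant ρ χ) :
    totalEnergy μ R a f φ χ = totalEnergy μ R a f χ φ := by
  unfold totalEnergy
  rw [mass_transport hunimod μ hproper hR
    (fun u v => ENNReal.ofReal (a u v * f (dist (φ u) (χ v))))]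
  · congr! 5 with u v
    rw [hW.a_symm, dist_comm]
  · intro γ u v
    rw [hW.a_smul, hφ, hχ, (ρ γ).dist_eq]
  · intro u
    refine (N u).finite_toSet.subset fun v hv => ?_
    rw [Finset.mem_coe, hW.mem_iff]
    rintro h
    simp [h] at hv
  · intro v
    refine (N v).finite_toSet.subset fun u hu => ?_
    rw [Finset.mem_coe, hW.mem_iff, hW.a_symm]
    rintro h
    simp [h] at hu

/-- Mass transport moves the base point of a triangle from `u` to the vertex `v` of the opposite
edge; summing over `u` then gives `C` times the edge weight. -/
lemma orbitSum_triangles (hW : IsLinkWeight Γ N a b C) (hC : 0 ≤ C)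
    (hunimod : ∀ γ : Γ, Measure.modularCharacter γ = 1) (μ : Measure Γ) [μ.IsHaarMeasure]
    (hproper : IsProperlyDiscontinuousAction V Γ) {R : Finset V} (hR : IsOrbitTransversal Γ R)
    {g : V → V → ℝ} (hg : ∀ (γ : Γ) v w, g (γ • v) (γ • w) = g v w) :
    orbitSum μ R (fun u => ∑' v, ∑' w, ENNReal.ofReal (b u v w * g v w)) =
      ENNReal.ofReal C * orbitSum μ R (fun v => ∑' w, ENNReal.ofReal (a v w * g v w)) := by
  rw [mass_transport hunimod μ hproper hR
    (fun u v => ∑' w, ENNReal.ofReal (b u v w * g v w)), ← orbitSum_const_mul]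
  · congr 1
    ext v
    rw [ENNReal.tsum_comm, ← ENNReal.tsum_mul_left]
    refine tsum_congr fun w => ?_
    simp only [ENNReal.ofReal_mul (hW.b_nonneg _ _ _)]
    rw [ENNReal.tsum_mul_right, ← ENNReal.ofReal_mul hC, ← mul_assoc, ← hW.sum_b,
      ENNReal.ofReal_mul (Finset.sum_nonneg fun u _ => hW.b_nonneg _ _ _),
      ENNReal.ofReal_sum_of_nonneg fun u _ => hW.b_nonneg _ _ _, tsum_eq_sum (s := N v)]
    intro u hu
    by_contra h
    refine hu (hW.mem_of_b v u w ?_).1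
    rw [hW.b_swap]
    rintro h0
    simp [h0] at h
  · intro γ u v
    rw [← (MulAction.toPerm γ).tsum_eq]
    refine tsum_congr fun w => ?_
    rw [MulAction.toPerm_apply, hW.b_smul, hg]
  · intro u
    refine (N u).finite_toSet.subset fun v hv => ?_
    by_contra h
    refine hv (ENNReal.tsum_eq_zero.2 fun w => ?_)
    have : b u v w = 0 := by
      by_contra h0
      exact h (hW.mem_of_b u v w h0).1
    simp [this]
  · intro v
    refine (N v).finite_toSet.subset fun u hu => ?_
    by_contra h
    refine hu (ENNReal.tsum_eq_zero.2 fun w => ?_)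
    have : b u v w = 0 := by
      by_contra h0
      rw [hW.b_swap] at h0
      exact h (hW.mem_of_b v u w h0).1
    simp [this]

/-- The Poincaré inequalities in the links yield a global one. -/
lemma totalEnergy_minimizer_le (hW : IsLinkWeight Γ N a b C) (hf : IsEnergyFunction f)
    (hC : 0 ≤ C)
    (hunimod : ∀ γ : Γ, Measure.modularCharacter γ = 1) (μ : Measure Γ) [μ.IsHaarMeasure]
    (hproper : IsProperlyDiscontinuousAction V Γ) {R : Finset V} (hR : IsOrbitTransversal Γ R)
    {ρ : Γ →* (Z ≃ᵢ Z)} {φ χ : V → Z} (hφ : IsEquivariant ρ φ) {l : ℝ} (hl : 0 < l)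
    (h : ∀ u, l * localEnergy N a f u φ (χ u) ≤ localLinkEnergy N b f u φ) :
    totalEnergy μ R a f χ φ ≤ ENNReal.ofReal (C / 2 / l) * totalEnergy μ R a f φ φ := by
  -- Doubling removes the factor `1 / 2` in the link energy, the source of the threshold `C / 2`.
  have h1 : orbitSum μ R (fun u => ENNReal.ofReal (2 * l) *
        ∑' v, ENNReal.ofReal (a u v * f (dist (χ u) (φ v)))) ≤
      orbitSum μ R (fun u => ∑' v, ∑' w, ENNReal.ofReal (b u v w * f (dist (φ v) (φ w)))) := by
    refine orbitSum_mono fun u => ?_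
    rw [hW.tsum_eq_localEnergy hf, hW.tsum_tsum_ofReal_mul u fun v w => hf.nonneg dist_nonneg,
      ← ENNReal.ofReal_mul (by positivity)]
    refine ENNReal.ofReal_le_ofReal ?_
    have h2 : ∑ v ∈ N u, ∑ w ∈ N u, b u v w * f (dist (φ v) (φ w)) =
        2 * localLinkEnergy N b f u φ := by
      simp only [localLinkEnergy, Finset.mul_sum]
      refine Finset.sum_congr rfl fun v _ => Finset.sum_congr rfl fun w _ => ?_
      ring
    rw [h2]
    linarith [h u]
  rw [orbitSum_const_mul, hW.orbitSum_triangles hC hunimod μ hproper hR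
    (fun γ v w => by rw [hφ, hφ, (ρ γ).dist_eq])] at h1
  have h2 := mul_le_mul_right h1 (ENNReal.ofReal (2 * l)⁻¹)
  rw [← mul_assoc, ← mul_assoc, ← ENNReal.ofReal_mul (by positivity),
    ← ENNReal.ofReal_mul (by positivity), inv_mul_cancel₀ (by positivity), ENNReal.ofReal_one,
    one_mul] at h2
  have h3 : (2 * l)⁻¹ * C = C / 2 / l := by
    field_simp
  rwa [h3] at h2

lemma totalEnergy_mid_le (hW : IsLinkWeight Γ N a b C) (hf : IsEnergyFunction f)
    (hunimod : ∀ γ : Γ, Measure.modularCharacter γ = 1) (μ : Measure Γ) [μ.IsHaarMeasure]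
    (hproper : IsProperlyDiscontinuousAction V Γ) {R : Finset V} (hR : IsOrbitTransversal Γ R)
    {mid : Z → Z → Z} (hM : IsConvexMidpoint mid)
    {ρ : Γ →* (Z ≃ᵢ Z)} {φ χ : V → Z} (hφ : IsEquivariant ρ φ) (hχ : IsEquivariant ρ χ) :
    totalEnergy μ R a f (fun u => mid (φ u) (χ u)) (fun u => mid (φ u) (χ u)) ≤
      totalEnergy μ R a f χ φ := by
  have h1 : (2 : ENNReal) * totalEnergy μ R a f (fun u => mid (φ u) (χ u))
      (fun u => mid (φ u) (χ u)) ≤ 2 * totalEnergy μ R a f χ φ := by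
    calc _ ≤ totalEnergy μ R a f φ χ + totalEnergy μ R a f χ φ := by
          unfold totalEnergy
          rw [← orbitSum_const_mul, ← orbitSum_add]
          refine orbitSum_mono fun u => ?_
          rw [← ENNReal.tsum_mul_left, ← ENNReal.tsum_add]
          refine ENNReal.tsum_le_tsum fun v => ?_
          rw [← ENNReal.ofReal_add (hW.term_nonneg hf _ _ _ _) (hW.term_nonneg hf _ _ _ _),
            ← ENNReal.ofReal_ofNat 2, ← ENNReal.ofReal_mul zero_le_two]
          refine ENNReal.ofReal_le_ofReal ?_
          -- The second midpoint is taken in the reversed order, so that `φ` is paired with `χ` and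
          -- not with itself.
          have h2 := hM.dist_mid_mid_le (φ u) (χ u) (χ v) (φ v)
          rw [hM.symm (χ v)] at h2
          have h3 := (hf.mono dist_nonneg h2).trans (hf.midpoint_le dist_nonneg dist_nonneg)
          have := mul_le_mul_of_nonneg_left h3 (hW.a_nonneg u v)
          linarith
      _ = _ := by rw [hW.totalEnergy_comm hunimod μ hproper hR hφ hχ, two_mul]
  exact (ENNReal.mul_le_mul_iff_right two_ne_zero ENNReal.ofNat_ne_top).1 h1

/-- The fixed point theorem, for an abstract notion of midpoint. -/
theorem exists_fixedPoint [Nonempty V] [Nonempty Z] [CompleteSpace Z]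
    (hW : IsLinkWeight Γ N a b C) (hf : IsEnergyFunction f)
    (hunimod : ∀ γ : Γ, Measure.modularCharacter γ = 1)
    (hproper : IsProperlyDiscontinuousAction V Γ) {R : Finset V} (hR : IsOrbitTransversal Γ R)
    (hconn : ∀ u v, Relation.ReflTransGen (fun u v => v ∈ N u) u v)
    {mid : Z → Z → Z} (hM : IsConvexMidpoint mid)
    {ρ : Γ →* (Z ≃ᵢ Z)} (hρ : ∀ z : Z, Continuous fun γ : Γ => ρ γ z)
    (hfix : HasCompactFixedPoints mid ρ) {l : ℝ} (hl : C / 2 < l)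
    (h : ∀ u (φ : V → Z) ξ, (∀ ζ, localEnergy N a f u φ ξ ≤ localEnergy N a f u φ ζ) →
      l * localEnergy N a f u φ ξ ≤ localLinkEnergy N b f u φ) :
    ∃ z : Z, ∀ γ, ρ γ z = z := by
  let μ : Measure Γ := Measure.haar
  have hC := hW.constant_nonneg
  have hl0 : 0 < l := by linarith
  set κ := C / 2 / l
  have hκ0 : 0 ≤ κ := by positivity
  have hκ1 : κ < 1 := by rwa [div_lt_one hl0]
  have hmin : ∀ φ : {φ : V → Z // IsEquivariant ρ φ}, ∃ χ : V → Z, IsEquivariant ρ χ ∧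
      ∀ u ζ, localEnergy N a f u φ.1 (χ u) ≤ localEnergy N a f u φ.1 ζ := fun φ =>
    hW.exists_isEquivariant_minimizer hf hM hfix hproper φ.2
  choose M hMeq hMmin using hmin
  let step : {φ : V → Z // IsEquivariant ρ φ} → {φ : V → Z // IsEquivariant ρ φ} := fun φ =>
    ⟨fun u => mid (φ.1 u) (M φ u), fun γ u => by simp only [hM.map_mid, φ.2 γ u, hMeq φ γ u]⟩
  obtain ⟨φ₀, hφ₀⟩ := exists_isEquivariant_map (V := V) hM hρ hfix hproper
  let Φ : ℕ → {φ : V → Z // IsEquivariant ρ φ} := fun k => step^[k] ⟨φ₀, hφ₀⟩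
  have hΦ : ∀ k, Φ (k + 1) = step (Φ k) := fun k => Function.iterate_succ_apply' _ _ _
  set D : ℕ → ℝ := fun k => (totalEnergy μ R a f (Φ k).1 (Φ k).1).toReal
  have hDstep : ∀ k, D (k + 1) ≤ κ * D k := fun k => by
    have h1 := (hW.totalEnergy_mid_le hf hunimod μ hproper hR hM (Φ k).2 (hMeq (Φ k))).trans
      (hW.totalEnergy_minimizer_le hf hC hunimod μ hproper hR (Φ k).2 hl0
        fun u => h u _ _ (hMmin (Φ k) u))
    have h2 := ENNReal.toReal_mono (ENNReal.mul_ne_top ENNReal.ofReal_ne_top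
      (hW.totalEnergy_ne_top hf μ hproper R (Φ k).1 (Φ k).1)) h1
    rw [ENNReal.toReal_mul, ENNReal.toReal_ofReal hκ0] at h2
    simp only [D, hΦ k]
    exact h2
  have hD : ∀ k, D k ≤ D 0 * κ ^ k := fun k => by
    induction k with
    | zero => simp
    | succ k ih =>
      refine (hDstep k).trans ((mul_le_mul_of_nonneg_left ih hκ0).trans_eq ?_)
      ring
  have hlocal : ∀ u, ∃ K : ℝ, 0 ≤ K ∧ ∀ k,
      localEnergy N a f u (Φ k).1 ((Φ k).1 u) ≤ K * κ ^ k := fun u => by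
    obtain ⟨K, hK0, hK⟩ := hW.exists_localEnergy_le hf μ hproper hR ρ u
    refine ⟨K * D 0, mul_nonneg hK0 ENNReal.toReal_nonneg, fun k => ?_⟩
    rw [mul_assoc]
    exact (hK _ (Φ k).2).trans (mul_le_mul_of_nonneg_left (hD k) hK0)
  obtain ⟨u₀⟩ := ‹Nonempty V›
  -- The index is shifted because the summability hypothesis starts at the exponent `1`.
  have hcauchy : CauchySeq fun k => (Φ (k + 1)).1 u₀ := by
    obtain ⟨K, hK0, hK⟩ := hlocal u₀
    obtain ⟨v, hv⟩ := hW.nonempty u₀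
    have ha := hW.a_pos hv
    refine cauchySeq_of_dist_le_of_summable _ (fun k => ?_)
      (hf.summable κ (K / a u₀ v) hκ0 hκ1 (by positivity))
    refine hf.le_invFunOn dist_nonneg ?_
    have h1 := (hW.map_dist_mid_le hf hM hv (hMmin (Φ (k + 1)) u₀ _)).trans (hK (k + 1))
    rw [div_mul_eq_mul_div, le_div_iff₀' ha, hΦ (k + 1)]
    exact h1
  have hedge : ∀ u, ∀ v ∈ N u,
      Tendsto (fun k => dist ((Φ k).1 u) ((Φ k).1 v)) atTop (nhds 0) := by
    intro u v hv
    obtain ⟨K, hK0, hK⟩ := hlocal u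
    have hlim : Tendsto (fun k : ℕ => K * κ ^ k) atTop (nhds 0) := by
      simpa using (tendsto_pow_atTop_nhds_zero_of_lt_one hκ0 hκ1).const_mul K
    rw [Metric.tendsto_nhds]
    intro ε hε
    have hfε : 0 < a u v * f ε := by
      have := hf.strictMono Set.self_mem_Ici hε.le hε
      rw [hf.map_zero] at this
      exact mul_pos (hW.a_pos hv) this
    filter_upwards [hlim.eventually_lt_const hfε] with k hk
    rw [Real.dist_0_eq_abs, abs_of_nonneg dist_nonneg]
    by_contra! hcon
    have h1 := mul_le_mul_of_nonneg_left (hf.mono hε.le hcon) (hW.a_nonneg u v)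
    have h2 := hW.le_localEnergy hf hv (Φ k).1 ((Φ k).1 u)
    linarith [hK k]
  have hall : ∀ u v, Tendsto (fun k => dist ((Φ k).1 u) ((Φ k).1 v)) atTop (nhds 0) := by
    intro u v
    induction hconn u v with
    | refl => simp
    | @tail v w _ hvw ih =>
      refine squeeze_zero (fun _ => dist_nonneg)
        (fun k => dist_triangle ((Φ k).1 u) ((Φ k).1 v) ((Φ k).1 w)) ?_
      simpa using ih.add (hedge _ _ hvw)
  obtain ⟨z, hz⟩ := cauchySeq_tendsto_of_complete hcauchy
  refine ⟨z, fun γ => ?_⟩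
  -- The values at `γ • u₀` approach those at `u₀`, hence `z`; by equivariance they also converge to
  -- `ρ γ z`.
  have h1 : Tendsto (fun k => dist ((Φ (k + 1)).1 (γ • u₀)) ((Φ (k + 1)).1 u₀)) atTop (nhds 0) :=
    (hall _ _).comp (tendsto_add_atTop_nat 1)
  have h2 : Tendsto (fun k => dist ((Φ (k + 1)).1 (γ • u₀)) ((Φ (k + 1)).1 u₀)) atTop
      (nhds (dist (ρ γ z) z)) := by
    simp only [fun k => (Φ (k + 1)).2 γ u₀]
    exact (((ρ γ).continuous.tendsto z).comp hz).dist hz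
  exact dist_eq_zero.1 (tendsto_nhds_unique h2 h1)

end Unimodular

end IsLinkWeight

end TotalEnergy

/-! ### From weighted complexes to abstract weights -/

section Complex

variable {V : Type*} {X : AbstractSimplicialComplex V}

open Classical in
lemma pair_mem_orderedSimplices {u v : V} :
    ![u, v] ∈ orderedSimplices X 1 ↔ u ≠ v ∧ ({u, v} : Finset V) ∈ X.faces := by
  have h1 : Function.Injective ![u, v] ↔ u ≠ v := by
    constructor
    · rintro h rfl
      exact absurd (@h 0 1 rfl) (by decide)
    · intro h i j hij
      fin_cases i <;> fin_cases j <;> simp_all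
  have h2 : ∀ s : Finset V, (s : Set V) = Set.range ![u, v] ↔ s = {u, v} := fun s => by
    rw [← Finset.coe_inj, Finset.coe_pair, Matrix.range_cons, Matrix.range_cons,
      Matrix.range_empty, Set.union_empty, Set.singleton_union]
  simp only [orderedSimplices, Set.mem_ofPred_eq, h1, h2, exists_eq_right, ne_eq]

open Classical in
lemma triple_mem_orderedSimplices {u v w : V} :
    ![u, v, w] ∈ orderedSimplices X 2 ↔
      (u ≠ v ∧ u ≠ w ∧ v ≠ w) ∧ ({u, v, w} : Finset V) ∈ X.faces := by
  have h1 : Function.Injective ![u, v, w] ↔ u ≠ v ∧ u ≠ w ∧ v ≠ w := by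
    constructor
    · refine fun h => ⟨?_, ?_, ?_⟩ <;> rintro rfl
      · exact absurd (@h 0 1 rfl) (by decide)
      · exact absurd (@h 0 2 rfl) (by decide)
      · exact absurd (@h 1 2 rfl) (by decide)
    · rintro ⟨h1, h2, h3⟩ i j hij
      fin_cases i <;> fin_cases j <;> simp_all
  have h2 : ∀ s : Finset V, (s : Set V) = Set.range ![u, v, w] ↔ s = {u, v, w} := fun s => by
    rw [← Finset.coe_inj, Finset.coe_insert, Finset.coe_pair, Matrix.range_cons, Matrix.range_cons,
      Matrix.range_cons, Matrix.range_empty, Set.union_empty, Set.singleton_union,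
      Set.singleton_union]
  simp only [orderedSimplices, Set.mem_ofPred_eq, h1, h2, exists_eq_right, ne_eq]

lemma comp_perm_mem_orderedSimplices {k : ℕ} {σ : Fin (k + 1) → V} (π : Equiv.Perm (Fin (k + 1)))
    (h : σ ∈ orderedSimplices X k) : σ ∘ π ∈ orderedSimplices X k :=
  ⟨h.1.comp π.injective, by
    rw [π.surjective.range_comp]
    exact h.2⟩

lemma smul_mem_orderedSimplices {Γ : Type*} [Group Γ] [MulAction Γ V]
    (hsimp : IsSimplicialAction Γ X) {k : ℕ} {σ : Fin (k + 1) → V} (γ : Γ)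
    (h : σ ∈ orderedSimplices X k) : (fun i => γ • σ i) ∈ orderedSimplices X k := by
  classical
  obtain ⟨hinj, s, hs, hsσ⟩ := h
  refine ⟨(MulAction.injective γ).comp hinj, γ • s, ?_, ?_⟩
  · convert hsimp γ s hs
  · rw [Finset.coe_smul_finset, hsσ, ← Set.range_smul]

lemma smul_pair_mem_iff {Γ : Type*} [Group Γ] [MulAction Γ V]
    (hsimp : IsSimplicialAction Γ X) (γ : Γ) {u v : V} :
    ![γ • u, γ • v] ∈ orderedSimplices X 1 ↔ ![u, v] ∈ orderedSimplices X 1 := by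
  have key : ∀ (γ : Γ) {u v : V}, ![u, v] ∈ orderedSimplices X 1 →
      ![γ • u, γ • v] ∈ orderedSimplices X 1 := fun γ u v h => by
    convert smul_mem_orderedSimplices hsimp γ h using 1
    ext i
    fin_cases i <;> rfl
  exact ⟨fun h => by simpa using key γ⁻¹ h, key γ⟩

lemma smul_triple_mem_iff {Γ : Type*} [Group Γ] [MulAction Γ V]
    (hsimp : IsSimplicialAction Γ X) (γ : Γ) {u v w : V} :
    ![γ • u, γ • v, γ • w] ∈ orderedSimplices X 2 ↔ ![u, v, w] ∈ orderedSimplices X 2 := by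
  have key : ∀ (γ : Γ) {u v w : V}, ![u, v, w] ∈ orderedSimplices X 2 →
      ![γ • u, γ • v, γ • w] ∈ orderedSimplices X 2 := fun γ u v w h => by
    convert smul_mem_orderedSimplices hsimp γ h using 1
    ext i
    fin_cases i <;> rfl
  exact ⟨fun h => by simpa using key γ⁻¹ h, key γ⟩

lemma pair_mem_comm {u v : V} :
    ![u, v] ∈ orderedSimplices X 1 ↔ ![v, u] ∈ orderedSimplices X 1 := by
  classical
  rw [pair_mem_orderedSimplices, pair_mem_orderedSimplices, ne_comm, Finset.pair_comm]

lemma triple_mem_swap {u v w : V} :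
    ![u, v, w] ∈ orderedSimplices X 2 ↔ ![v, u, w] ∈ orderedSimplices X 2 := by
  classical
  rw [triple_mem_orderedSimplices, triple_mem_orderedSimplices, Finset.insert_comm]
  tauto

lemma pairs_mem_of_triple_mem {u v w : V} (h : ![u, v, w] ∈ orderedSimplices X 2) :
    ![u, v] ∈ orderedSimplices X 1 ∧ ![u, w] ∈ orderedSimplices X 1 ∧
      ![v, w] ∈ orderedSimplices X 1 := by
  classical
  rw [triple_mem_orderedSimplices] at h
  obtain ⟨⟨huv, huw, hvw⟩, hf⟩ := h
  have hsub : ∀ s : Finset V, s ⊆ {u, v, w} → s.Nonempty → s ∈ X.faces :=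
    fun s hs hne => (X.isRelLowerSet_faces hf).2 hs hne
  simp only [pair_mem_orderedSimplices]
  refine ⟨⟨huv, hsub _ ?_ (by simp)⟩, ⟨huw, hsub _ ?_ (by simp)⟩, ⟨hvw, hsub _ ?_ (by simp)⟩⟩ <;>
  · intro x
    simp
    tauto

lemma singleton_mem_link_iff {u v : V} :
    {v} ∈ (link X u).faces ↔ ![u, v] ∈ orderedSimplices X 1 := by
  classical
  rw [pair_mem_orderedSimplices]
  simp only [link, Set.mem_ofPred_eq, Finset.singleton_nonempty, true_and, Finset.mem_singleton,
    ne_eq]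

lemma adj_link_iff {u : V} {v w : Vertex (link X u)} :
    (skeletonGraph (link X u)).Adj v w ↔ ![u, v.1, w.1] ∈ orderedSimplices X 2 := by
  classical
  have hv := (pair_mem_orderedSimplices.1 (singleton_mem_link_iff.1 v.2)).1
  have hw := (pair_mem_orderedSimplices.1 (singleton_mem_link_iff.1 w.2)).1
  rw [triple_mem_orderedSimplices]
  simp only [skeletonGraph, link, Set.mem_ofPred_eq, Finset.insert_nonempty, true_and,
    Finset.mem_insert, Finset.mem_singleton, ne_eq, Subtype.ext_iff, not_or]
  have : ∀ p : Prop, (¬ v.1 = w.1 ∧ (¬ u = v.1 ∧ ¬ u = w.1) ∧ p) ↔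
      ((¬ u = v.1 ∧ ¬ u = w.1 ∧ ¬ v.1 = w.1) ∧ p) := fun p => by tauto
  rw [← this]

/-- The neighbours of `u` in a locally finite complex. -/
noncomputable def neighbors (hfin : ∀ u : V, (link X u).faces.Finite) (u : V) : Finset V :=
  Set.Finite.toFinset (s := {v | ![u, v] ∈ orderedSimplices X 1}) (by
    refine ((hfin u).preimage (f := fun v => ({v} : Finset V))
      Finset.singleton_injective.injOn).subset fun v hv => ?_
    exact singleton_mem_link_iff.2 hv)

lemma mem_neighbors {hfin : ∀ u : V, (link X u).faces.Finite} {u v : V} :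
    v ∈ neighbors hfin u ↔ ![u, v] ∈ orderedSimplices X 1 := by
  simp [neighbors]

variable (X) (m : (k : ℕ) → (Fin (k + 1) → V) → ℝ)

open Classical in
/-- The weight of oriented edges, extended by zero. -/
noncomputable def edgeWeight (u v : V) : ℝ :=
  if ![u, v] ∈ orderedSimplices X 1 then m 1 ![u, v] else 0

open Classical in
/-- The weight of oriented triangles, extended by zero. -/
noncomputable def triangleWeight (u v w : V) : ℝ :=
  if ![u, v, w] ∈ orderedSimplices X 2 then m 2 ![u, v, w] else 0

variable {X m}

lemma exists_perm_fin_three :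
    ∀ i j : Fin 3, i ≠ j → ∃ π : Equiv.Perm (Fin 3), π i = 1 ∧ π j = 2 := by
  decide

variable {Γ : Type*} [Group Γ] [MulAction Γ V] {C : ℝ}

/-- Each triangle containing an edge `(v, w)` has six orderings, only one of which is of the form
`(u, v, w)`. -/
lemma IsWeight.sum_triangleWeight (hm : IsWeight Γ X m C)
    (hfin : ∀ u : V, (link X u).faces.Finite) (v w : V) :
    ∑ u ∈ neighbors hfin v, triangleWeight X m u v w = C * edgeWeight X m v w := by
  classical
  by_cases hvw : ![v, w] ∈ orderedSimplices X 1
  · rw [edgeWeight, if_pos hvw]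
    set U := (neighbors hfin v).filter fun u => ![u, v, w] ∈ orderedSimplices X 2
    have hU : ∀ u, u ∈ U ↔ ![u, v, w] ∈ orderedSimplices X 2 := fun u => by
      simp only [U, Finset.mem_filter, and_iff_right_iff_imp, mem_neighbors]
      exact fun h => pair_mem_comm.1 (pairs_mem_of_triple_mem h).1
    let g : V × Equiv.Perm (Fin 3) → Fin 3 → V := fun p => ![p.1, v, w] ∘ p.2
    -- At the position where the first ordering shows `u`, the second can show neither `v` nor `w`,
    -- so it shows `u'`. With `u = u'`, injectivity of the triple recovers the permutation.
    have hginj : Set.InjOn g ((U ×ˢ Finset.univ : Finset (V × Equiv.Perm (Fin 3))) : Set _) := by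
      rintro ⟨u, π⟩ hu ⟨u', π'⟩ - hg
      have hu := (hU u).1 (Finset.mem_product.1 (Finset.mem_coe.1 hu)).1
      obtain ⟨⟨huv, huw, -⟩, -⟩ := triple_mem_orderedSimplices.1 hu
      have h1 := congrFun hg (π.symm 0)
      simp only [g, Function.comp_apply, Equiv.apply_symm_apply, Matrix.cons_val_zero] at h1
      obtain rfl : u = u' := by
        generalize π' (π.symm 0) = i at h1
        fin_cases i
        · exact h1
        · exact absurd h1 huv
        · exact absurd h1 huw
      congr 1
      ext i
      exact congrArg Fin.val (hu.1 (congrFun hg i))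
    have himage : {σ | σ ∈ orderedSimplices X 2 ∧ Set.range ![v, w] ⊆ Set.range σ} =
        g '' ((U ×ˢ Finset.univ : Finset (V × Equiv.Perm (Fin 3))) : Set _) := by
      ext σ
      constructor
      · rintro ⟨hσ, hsub⟩
        obtain ⟨i, hi⟩ := hsub ⟨0, rfl⟩
        obtain ⟨j, hj⟩ := hsub ⟨1, rfl⟩
        have hi : σ i = v := hi
        have hj : σ j = w := hj
        have hij : i ≠ j := by
          rintro rfl
          exact (pair_mem_orderedSimplices.1 hvw).1 (hi.symm.trans hj)
        obtain ⟨π, hπi, hπj⟩ := exists_perm_fin_three i j hij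
        have heq : σ ∘ π.symm = ![σ (π.symm 0), v, w] := by
          ext k
          fin_cases k
          · rfl
          · change σ (π.symm 1) = v
            rw [← hπi, π.symm_apply_apply, hi]
          · change σ (π.symm 2) = w
            rw [← hπj, π.symm_apply_apply, hj]
        refine ⟨(σ (π.symm 0), π), ?_, ?_⟩
        · rw [Finset.mem_coe, Finset.mem_product]
          refine ⟨(hU _).2 ?_, Finset.mem_univ _⟩
          rw [← heq]
          exact comp_perm_mem_orderedSimplices π.symm hσ
        · simp only [g, ← heq]
          ext k
          simp
      · rintro ⟨⟨u, π⟩, hu, rfl⟩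
        have hu := (hU u).1 (Finset.mem_product.1 (Finset.mem_coe.1 hu)).1
        refine ⟨comp_perm_mem_orderedSimplices π hu, ?_⟩
        simp only [g]
        rw [π.surjective.range_comp]
        rintro _ ⟨i, rfl⟩
        fin_cases i
        · exact ⟨1, rfl⟩
        · exact ⟨2, rfl⟩
    have key := hm.sum_eq _ hvw
    rw [himage, finsum_mem_image hginj, finsum_mem_coe_finset, Finset.sum_product] at key
    -- The six equal terms cancel the factor `3!` in the definition of the weight constant.
    have h6 : ∀ u ∈ U, ∑ π : Equiv.Perm (Fin 3), m 2 (g (u, π)) = 6 * m 2 ![u, v, w] := by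
      intro u hu
      rw [Finset.sum_congr rfl fun π _ =>
        hm.symmetric 2 one_le_two le_rfl _ ((hU u).1 hu) π]
      simp [Finset.card_univ, Fintype.card_perm, Nat.factorial]
    rw [Finset.sum_congr rfl h6, ← Finset.mul_sum] at key
    have hsum : ∑ u ∈ neighbors hfin v, triangleWeight X m u v w = ∑ u ∈ U, m 2 ![u, v, w] := by
      rw [Finset.sum_filter]
      rfl
    rw [hsum]
    norm_num [Nat.factorial] at key
    linarith
  · rw [edgeWeight, if_neg hvw, mul_zero]
    refine Finset.sum_eq_zero fun u _ => if_neg fun h => hvw (pairs_mem_of_triple_mem h).2.2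

/-- A weight on a complex gives rise to an abstract one. -/
lemma IsWeight.isLinkWeight (hm : IsWeight Γ X m C) (hsimp : IsSimplicialAction Γ X)
    (hconn : ∀ u : V, IsConnectedComplex (link X u))
    (hfin : ∀ u : V, (link X u).faces.Finite) :
    IsLinkWeight Γ (neighbors hfin) (edgeWeight X m) (triangleWeight X m) C where
  a_nonneg u v := by
    unfold edgeWeight
    split_ifs with h
    · exact (hm.pos 1 le_rfl one_le_two _ h).le
    · exact le_rfl
  a_symm u v := by
    unfold edgeWeight
    rw [pair_mem_comm]
    split_ifs with h
    · rw [← hm.symmetric 1 le_rfl one_le_two _ h (Equiv.swap 0 1)]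
      congr 1
      ext i
      fin_cases i <;> rfl
    · rfl
  a_smul γ u v := by
    unfold edgeWeight
    rw [smul_pair_mem_iff hsimp]
    split_ifs with h
    · rw [← hm.equivariant 1 le_rfl one_le_two _ h γ]
      congr 1
      ext i
      fin_cases i <;> rfl
    · rfl
  mem_iff u v := by
    rw [mem_neighbors, edgeWeight]
    split_ifs with h
    · simpa [h] using (hm.pos 1 le_rfl one_le_two _ h).ne'
    · simpa using h
  nonempty u := by
    obtain ⟨v⟩ := (hconn u).nonempty
    exact ⟨v.1, mem_neighbors.2 (singleton_mem_link_iff.1 v.2)⟩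
  b_nonneg u v w := by
    unfold triangleWeight
    split_ifs with h
    · exact (hm.pos 2 one_le_two le_rfl _ h).le
    · exact le_rfl
  b_swap u v w := by
    unfold triangleWeight
    rw [triple_mem_swap]
    split_ifs with h
    · rw [← hm.symmetric 2 one_le_two le_rfl _ h (Equiv.swap 0 1)]
      congr 1
      ext i
      fin_cases i <;> rfl
    · rfl
  b_smul γ u v w := by
    unfold triangleWeight
    rw [smul_triple_mem_iff hsimp]
    split_ifs with h
    · rw [← hm.equivariant 2 one_le_two le_rfl _ h γ]
      congr 1
      ext i
      fin_cases i <;> rfl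
    · rfl
  mem_of_b u v w h := by
    have : ![u, v, w] ∈ orderedSimplices X 2 := by
      by_contra h0
      exact h (if_neg h0)
    have := pairs_mem_of_triple_mem this
    exact ⟨mem_neighbors.2 this.1, mem_neighbors.2 this.2.1⟩
  sum_b := hm.sum_triangleWeight hfin

lemma finsum_link_vertex (hfin : ∀ u : V, (link X u).faces.Finite) (u : V) (g : V → ℝ) :
    ∑ᶠ v : Vertex (link X u), g v.1 = ∑ v ∈ neighbors hfin u, g v := by
  rw [finsum_subtype_eq_finsum_cond (f := g) (p := fun v => {v} ∈ (link X u).faces)]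
  exact finsum_cond_eq_sum_of_cond_iff _ fun _ => by
    rw [mem_neighbors, singleton_mem_link_iff]

variable {Z : Type*} [MetricSpace Z] {f : ℝ → ℝ}

lemma vertexEnergy_eq (hfin : ∀ u : V, (link X u).faces.Finite) (u : V) (φ : V → Z) (ξ : Z) :
    vertexEnergy X m f u (fun v => φ v.1) ξ =
      localEnergy (neighbors hfin) (edgeWeight X m) f u φ ξ := by
  rw [vertexEnergy, finsum_link_vertex hfin u fun v => m 1 ![u, v] * f (dist ξ (φ v))]
  refine Finset.sum_congr rfl fun v hv => ?_
  rw [edgeWeight, if_pos (mem_neighbors.1 hv)]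

lemma linkEnergy_eq (hfin : ∀ u : V, (link X u).faces.Finite) (u : V) (φ : V → Z) :
    linkEnergy X m f u (fun v => φ v.1) =
      localLinkEnergy (neighbors hfin) (triangleWeight X m) f u φ := by
  classical
  have h1 : ∀ v w : Vertex (link X u),
      (∑ᶠ _ : (skeletonGraph (link X u)).Adj v w,
        m 2 ![u, v.1, w.1] / 2 * f (dist (φ v.1) (φ w.1))) =
      triangleWeight X m u v.1 w.1 / 2 * f (dist (φ v.1) (φ w.1)) := fun v w => by
    rw [finsum_eq_if, adj_link_iff, triangleWeight]
    split_ifs <;> simp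
  unfold linkEnergy localLinkEnergy
  simp only [h1]
  rw [← finsum_link_vertex hfin u]
  refine finsum_congr fun v => ?_
  rw [← finsum_link_vertex hfin u]

/-- Any real `l` strictly between `C / 2` and the infimum serves all links at once: each link has an
admissible constant above `l`, and energies are nonnegative. The strict gap avoids asking whether
the supremum is attained or finite. -/
lemma exists_poincare_constant (hfin : ∀ u : V, (link X u).faces.Finite)
    (hW : IsLinkWeight Γ (neighbors hfin) (edgeWeight X m) (triangleWeight X m) C)
    (hf : IsEnergyFunction f) (hlam : ((C / 2 : ℝ) : EReal) < minLinkConstant Z X m f) :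
    ∃ l : ℝ, C / 2 < l ∧ ∀ (u : V) (φ : V → Z) (ξ : Z),
      (∀ ζ, localEnergy (neighbors hfin) (edgeWeight X m) f u φ ξ ≤
        localEnergy (neighbors hfin) (edgeWeight X m) f u φ ζ) →
      l * localEnergy (neighbors hfin) (edgeWeight X m) f u φ ξ ≤
        localLinkEnergy (neighbors hfin) (triangleWeight X m) f u φ := by
  obtain ⟨l, hl, hl'⟩ := EReal.lt_iff_exists_real_btwn.1 hlam
  refine ⟨l, EReal.coe_lt_coe_iff.1 hl, fun u φ ξ hξ => ?_⟩
  obtain ⟨_, ⟨l', hmem, rfl⟩, hlt⟩ := lt_sSup_iff.1 (hl'.trans_le (iInf_le _ u))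
  have h1 := hmem (fun v => φ v.1) ξ fun ζ => by
    rw [vertexEnergy_eq hfin, vertexEnergy_eq hfin]
    exact hξ ζ
  rw [vertexEnergy_eq hfin, linkEnergy_eq hfin] at h1
  exact (mul_le_mul_of_nonneg_right (EReal.coe_lt_coe_iff.1 hlt).le
    (hW.localEnergy_nonneg hf u φ ξ)).trans h1

lemma reflTransGen_neighbors (hfin : ∀ u : V, (link X u).faces.Finite)
    (hconn : IsConnectedComplex X.toPreAbstractSimplicialComplex) (u v : V) :
    Relation.ReflTransGen (fun u v => v ∈ neighbors hfin u) u v := by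
  classical
  have h := (SimpleGraph.reachable_iff_reflTransGen _ _).1
    (hconn.preconnected ⟨u, X.singleton_mem u⟩ ⟨v, X.singleton_mem v⟩)
  refine h.lift Subtype.val fun a b hab => ?_
  rw [Function.onFun, mem_neighbors, pair_mem_orderedSimplices]
  refine ⟨fun h => hab.1 (Subtype.ext h), ?_⟩
  convert hab.2

lemma IsCocompactAction.exists_isOrbitTransversal (h : IsCocompactAction Γ X) :
    ∃ R : Finset V, IsOrbitTransversal Γ R := by
  classical
  obtain ⟨F, hF, -, hFX⟩ := h
  refine LinkFixedPoint.exists_isOrbitTransversal (hF.toFinset.biUnion id) fun v => ?_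
  obtain ⟨γ, t, ht, hv⟩ := hFX {v} (X.singleton_mem v)
  have hvt : v ∈ γ • t := by
    have := Finset.mem_singleton_self v
    rw [hv] at this
    convert this
  obtain ⟨x, hx, rfl⟩ := Finset.mem_smul_finset.1 hvt
  exact ⟨x, Finset.mem_biUnion.2 ⟨t, hF.mem_toFinset.2 ht, hx⟩, MulAction.mem_orbit x γ⟩

/-- The fixed point theorem for spaces with convex midpoints. -/
theorem everyIsometricActionHasFixedPoint_of_midpoint
    (hconn : IsConnectedComplex X.toPreAbstractSimplicialComplex)
    (hlink_conn : ∀ u : V, IsConnectedComplex (link X u))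
    (hlink_fin : ∀ u : V, (link X u).faces.Finite)
    [TopologicalSpace Γ] [IsTopologicalGroup Γ] [LocallyCompactSpace Γ]
    (hunimod : ∀ γ : Γ, MeasureTheory.Measure.modularCharacter γ = 1)
    (hsimp : IsSimplicialAction Γ X)
    (hproper : IsProperlyDiscontinuousAction V Γ) (hcocpt : IsCocompactAction Γ X)
    (hm : IsWeight Γ X m C) (hf : IsEnergyFunction f)
    [CompleteSpace Z] [Nonempty Z] {mid : Z → Z → Z} (hM : IsConvexMidpoint mid)
    (hfix : ∀ ρ : Γ →* (Z ≃ᵢ Z), (∀ z : Z, Continuous fun γ : Γ => ρ γ z) →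
      HasCompactFixedPoints mid ρ)
    (hlam : ((C / 2 : ℝ) : EReal) < minLinkConstant Z X m f) :
    EveryIsometricActionHasFixedPoint Γ Z := by
  intro ρ hρ
  borelize Γ
  have hW := hm.isLinkWeight hsimp hlink_conn hlink_fin
  obtain ⟨R, hR⟩ := hcocpt.exists_isOrbitTransversal
  obtain ⟨l, hl, hpoincare⟩ := exists_poincare_constant (Z := Z) hlink_fin hW hf hlam
  have : Nonempty V := hconn.nonempty.map Subtype.val
  exact hW.exists_fixedPoint hf hunimod hproper hR (reflTransGen_neighbors hlink_fin hconn) hM hρ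
    (hfix ρ hρ) hl hpoincare

end Complex

end LinkFixedPoint

open LinkFixedPoint
theorem theorem3p4 {V Γ : Type*} (X : AbstractSimplicialComplex V) (n : ℕ) (hn : 2 ≤ n)
    (hdim : HasDimension X n)
    (hconn : IsConnectedComplex X.toPreAbstractSimplicialComplex)
    (hlink_conn : ∀ u : V, IsConnectedComplex (link X u))
    (hlink_fin : ∀ u : V, (link X u).faces.Finite)
    [Group Γ] [TopologicalSpace Γ] [IsTopologicalGroup Γ] [LocallyCompactSpace Γ]
    (hunimod : ∀ γ : Γ, MeasureTheory.Measure.modularCharacter γ = 1)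
    [MulAction Γ V] (hsimp : IsSimplicialAction Γ X)
    (hproper : IsProperlyDiscontinuousAction V Γ) (hcocpt : IsCocompactAction Γ X)
    (m : (k : ℕ) → (Fin (k + 1) → V) → ℝ) (C : ℝ) (hm : IsWeight Γ X m C)
    (f : ℝ → ℝ) (hf : IsEnergyFunction f) :
    (∀ (Z : Type*) [MetricSpace Z] [CompleteSpace Z] [Nonempty Z],
      IsUniquelyGeodesic Z → IsUniformlyConvex Z → IsBusemannNPC Z →
      ((C / 2 : ℝ) : EReal) < minLinkConstant Z X m f →
      EveryIsometricActionHasFixedPoint Γ Z) ∧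
    (∀ (Z : Type*) [NormedAddCommGroup Z] [NormedSpace ℝ Z] [CompleteSpace Z],
      IsReflexive Z →
      ((C / 2 : ℝ) : EReal) < minLinkConstant Z X m f →
      EveryIsometricActionHasFixedPoint Γ Z) := by
  refine ⟨fun Z _ _ _ hg hu hb hlam => ?_, fun Z _ _ _ hr hlam => ?_⟩
  · exact everyIsometricActionHasFixedPoint_of_midpoint hconn hlink_conn hlink_fin hunimod hsimp
      hproper hcocpt hm hf (isConvexMidpoint_geodesicMid hg hu hb)
      (hasCompactFixedPoints_geodesicMid hg hu hb) hlam
  · exact everyIsometricActionHasFixedPoint_of_midpoint hconn hlink_conn hlink_fin hunimod hsimp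
      hproper hcocpt hm hf hr.isConvexMidpoint hasCompactFixedPoints_midpoint hlam
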